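/- Let $m\ge 1$, let $f:\mathbb R\to\mathbb R$ be locally Lipschitz and even, and put $F(s)=\int_0^s f(\sigma)\,d\sigma$. Assume that for some $s_0>0$ we have $F(s_0)=0$, $F<0$ on $(0,s_0)$, and $F$ is positive, nondecreasing and unbounded on $(s_0,\infty)$. For $i\ne j$ in $\{1,\dots,m\}$ let $\gamma_{ij}:\mathbb R\to\mathbb R$ be locally Lipschitz with $\gamma_{ij}(0)=0$ and $s\gamma_{ij}(s)\ge 0$ for all $s$, and such that either $\gamma_{ij}\equiv 0$ or there is a continuous, strictly increasing $\alpha:\mathbb R_{\ge 0}\to\mathbb R_{\ge 0}$ with $\alpha(0)=0$ and $|\gamma_{ij}(s)|\ge\alpha(|s|)$ for all $s$. Assume that the directed graph on $\{1,\dots,m\}$ with an edge from $i$ to $j$ exactly when $i\neq j$ and $\gamma_{ij}\not\equiv 0$ has a node to which there is a directed path from every other node. For $x=(x_1,\dots,x_m)\in(\mathbb R^2)^m=\mathbb R^{2m}$ and $\varphi\in\mathbb R$ let $u(\varphi)=(\cos\varphi,\sin\varphi)^T$, $w(\varphi)=(-\sin\varphi,\cos\varphi)^T$, and let $\ell^c(x,\varphi)\in\mathbb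 R^{2m}$ have blocks $$\ell^c_i(x,\varphi)=-f\big(u(\varphi)^Tx_i\big)\,\big(w(\varphi)^Tx_i\big)\,w(\varphi)+\sum_{j\ne i}\gamma_{ij}\big(w(\varphi)^T(x_j-x_i)\big)\,w(\varphi),\qquad i=1,\dots,m.$$ Let $\kappa(s)=\frac2\pi\int_0^s f(\sigma)\sqrt{1-\sigma^2/s^2}\,d\sigma$ for $s>0$. Theorem. There is exactly one $\rho>0$ with $\kappa(\rho)=0$, and for this $\rho$ the compact set $\mathcal B=\{x\in\mathbb R^{2m}:|x_i|\le\rho\text{ for all }i\}$ is semiglobally practically asymptotically stable with respect to $\omega$ for the system $\dot x=\ell^c(x,\omega t)$. That is, writing $|x|_{\mathcal B}$ for the Euclidean distance from $x$ to $\mathcal B$, for all $\Delta,\delta>0$ there is $\omega^*>0$ such that for every $\omega\ge\omega^*$ all solutions with $|x(t_0)|_{\mathcal B}<\Delta$, $t_0\in\mathbb R$, exist for all $t\ge t_0$, and the following hold, with constants independent of $t_0$ and of the solution: (a) for each $r>\delta$ there is $\varepsilon>0$ such that $|x(t_0)|_{\mathcal B}\le\varepsilon$ implies $|x(t)|_{\mathcal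 B}\le r$ for all $t\ge t_0$; (b) for each $\varepsilon<\Delta$ there is $r>0$ such that $|x(t_0)|_{\mathcal B}\le\varepsilon$ implies $|x(t)|_{\mathcal B}\le r$ for all $t\ge t_0$; (c) for each $r<\Delta$ and $\varepsilon>\delta$ there is $T>0$ such that $|x(t_0)|_{\mathcal B}\le r$ implies $|x(t)|_{\mathcal B}\le\varepsilon$ for all $t\ge t_0+T$. -/

import Mathlib

open scoped NNReal

namespace LienardArray

noncomputable section

/-- Class-K comparison functions on the nonnegative reals. -/
def IsClassK (α : ℝ≥0 → ℝ≥0) : Prop :=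
  Continuous α ∧ α 0 = 0 ∧ StrictMono α

/-- The functions `γ i j`, `i ≠ j`, describe an interconnection. The values `γ i i` are irrelevant
everywhere below. -/
def IsInterconnection {m : ℕ} (γ : Fin m → Fin m → ℝ → ℝ) : Prop :=
  ∀ i j : Fin m, i ≠ j →
    (γ i j 0 = 0 ∧ ∀ s : ℝ, 0 ≤ s * γ i j s) ∧
    ((∀ s : ℝ, γ i j s = 0) ∨
      ∃ α : ℝ≥0 → ℝ≥0, IsClassK α ∧ ∀ s : ℝ, (α ‖s‖₊ : ℝ) ≤ |γ i j s|)

/-- The directed graph with an edge from `i` to `j ≠ i` iff `γ i j` is not identically zero has a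
node to which there is a directed path from every other node. -/
def IsConnectedInterconnection {m : ℕ} (γ : Fin m → Fin m → ℝ → ℝ) : Prop :=
  ∃ l : Fin m, ∀ k : Fin m, k ≠ l →
    Relation.ReflTransGen (fun i j : Fin m => i ≠ j ∧ ∃ s : ℝ, γ i j s ≠ 0) k l

/-- The primitive `F` of `f` vanishing at zero. -/
def primitive (f : ℝ → ℝ) (s : ℝ) : ℝ := ∫ σ in (0 : ℝ)..s, f σ

/-- For some `s₀ > 0`: `F s₀ = 0`, `F` is negative on `(0, s₀)`, and `F` is positive, nondecreasing
and unbounded on `(s₀, ∞)`. -/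
def LienardSign (F : ℝ → ℝ) : Prop :=
  ∃ s₀ : ℝ, 0 < s₀ ∧ F s₀ = 0 ∧
    (∀ s ∈ Set.Ioo 0 s₀, F s < 0) ∧
    (∀ s ∈ Set.Ioi s₀, 0 < F s) ∧
    MonotoneOn F (Set.Ioi s₀) ∧
    ¬ BddAbove (F '' Set.Ioi s₀)

/-- `κ(s) = (2/π) ∫₀ˢ f(σ) √(1 - σ²/s²) dσ`, the radial part of the averaged damping; it is only
used at `s > 0`. -/
def kappa (f : ℝ → ℝ) (s : ℝ) : ℝ :=
  2 / Real.pi * ∫ σ in (0 : ℝ)..s, f σ * Real.sqrt (1 - σ ^ 2 / s ^ 2)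

/-- The phase plane with its Euclidean norm. -/
abbrev Plane : Type := EuclideanSpace ℝ (Fin 2)

/-- The state space `ℝ^{2m} = (ℝ²)^m` with its Euclidean norm. -/
abbrev State (m : ℕ) : Type := PiLp 2 (fun _ : Fin m => Plane)

/-- The linear functional `[cos φ  sin φ] v`. -/
def positionRow (φ : ℝ) (v : Plane) : ℝ := Real.cos φ * v 0 + Real.sin φ * v 1

/-- The linear functional `[-sin φ  cos φ] v`. -/
def velocityRow (φ : ℝ) (v : Plane) : ℝ := -Real.sin φ * v 0 + Real.cos φ * v 1

/-- The column vector `[-sin φ  cos φ]ᵀ`. -/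
def velocityCol (φ : ℝ) : Plane := !₂[-Real.sin φ, Real.cos φ]

/-- The `i`-th block of the right-hand side of the rotated array at phase `φ`. -/
def rotatedBlock {m : ℕ} (f : ℝ → ℝ) (γ : Fin m → Fin m → ℝ → ℝ) (x : State m) (φ : ℝ)
    (i : Fin m) : Plane :=
  -((f (positionRow φ (x i)) * velocityRow φ (x i)) • velocityCol φ) +
    ∑ j ∈ Finset.univ.erase i, γ i j (velocityRow φ (x j - x i)) • velocityCol φ

/-- The right-hand side `ℓᶜ(x, φ)` of the rotated array. -/
def rotatedField {m : ℕ} (f : ℝ → ℝ) (γ : Fin m → Fin m → ℝ → ℝ) (x : State m) (φ : ℝ) :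
    State m :=
  WithLp.toLp 2 (fun i => rotatedBlock f γ x φ i)

/-- The product of the closed discs of radius `ρ`. -/
def discProduct (m : ℕ) (ρ : ℝ) : Set (State m) := {η | ∀ i : Fin m, ‖η i‖ ≤ ρ}

/-- `x` solves `ẋ = g(x, ω, t)` on the time interval `I` (one-sided derivatives at end points). -/
def IsSolutionOn {E : Type*} [NormedAddCommGroup E] [NormedSpace ℝ E] (g : E → ℝ → ℝ → E) (ω : ℝ)
    (I : Set ℝ) (x : ℝ → E) : Prop :=
  ∀ t ∈ I, HasDerivWithinAt x (g (x t) ω t) I t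

/-- Semiglobal practical asymptotic stability, with respect to `ω`, of the closed set `S` for
`ẋ = g(x, ω, t)`. The first clause inside makes explicit that solutions starting at distance less
than `Δ` exist for all future times; the other three are the stability, boundedness and
attractivity estimates. Each estimate is required of every solution on every interval `[t₀, t]`,
uniformly in the initial time `t₀`. -/
def IsSPAS {E : Type*} [NormedAddCommGroup E] [NormedSpace ℝ E] (g : E → ℝ → ℝ → E)
    (S : Set E) : Prop :=
  IsClosed S ∧
  ∀ Δ δ : ℝ, 0 < Δ → 0 < δ → ∃ ωstar : ℝ, 0 < ωstar ∧ ∀ ω : ℝ, ωstar ≤ ω →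
    (∀ (t₀ : ℝ) (x₀ : E), Metric.infDist x₀ S < Δ →
      ∃ x : ℝ → E, x t₀ = x₀ ∧ IsSolutionOn g ω (Set.Ici t₀) x) ∧
    (∀ r : ℝ, δ < r → ∃ ε : ℝ, 0 < ε ∧
      ∀ (t₀ t : ℝ) (x : ℝ → E), t₀ ≤ t → IsSolutionOn g ω (Set.Icc t₀ t) x →
        Metric.infDist (x t₀) S ≤ ε → Metric.infDist (x t) S ≤ r) ∧
    (∀ ε : ℝ, ε < Δ → ∃ r : ℝ, 0 < r ∧
      ∀ (t₀ t : ℝ) (x : ℝ → E), t₀ ≤ t → IsSolutionOn g ω (Set.Icc t₀ t) x →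
        Metric.infDist (x t₀) S ≤ ε → Metric.infDist (x t) S ≤ r) ∧
    (∀ r ε : ℝ, r < Δ → δ < ε → ∃ T : ℝ, 0 < T ∧
      ∀ (t₀ t : ℝ) (x : ℝ → E), t₀ + T ≤ t → IsSolutionOn g ω (Set.Icc t₀ t) x →
        Metric.infDist (x t₀) S ≤ r → Metric.infDist (x t) S ≤ ε)

end

end LienardArray

/-! Up to a positive factor, `kappa f s` is `angularMoment f s`, the mean damping over one turn of a
block of norm `s`. Integration by parts expresses it through `F`: it is negative on `(0, s₀]`,
eventually positive, and `s² * angularMoment f s` increases strictly past `s₀`. So it has a single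
sign change, at `ρ` (`exists_angularMoment_zero`).

Stability follows from a direct period-by-period estimate of the largest block norm `v = max ‖x i‖`.
Averaged over a turn, the damping of a block of norm `p` contributes `-4 p² angularMoment f p`. The
averaged coupling is a nonnegative multiple of `x j - x i`, so it pushes block `i` outward by at
most a multiple of `p * (v - p)`, which vanishes for the largest block
(`integral_inner_rotatedField_le`). Freezing the state over a period costs only a second-order error
in the period (`norm_sq_le_of_isSolutionOn`). Hence, for fast rotation, `v` drops by a fixed rate
times the period whenever `ρ + d ≤ v ≤ R` (`exists_period_estimates`); iterating this gives global
existence and the three stability estimates. -/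

namespace LienardArray

noncomputable section

/-! ### Angular moment and the unique zero of `kappa` -/

section

open MeasureTheory Set intervalIntegral

/-- The angular moment `∫₀^{π/2} f (s sin θ) cos² θ dθ`, which is `kappa f s` up to the positive
factor `2 s / π`. -/
def angularMoment (f : ℝ → ℝ) (s : ℝ) : ℝ :=
  ∫ θ in (0 : ℝ)..(Real.pi / 2), f (s * Real.sin θ) * Real.cos θ ^ 2

theorem continuous_angularMoment {f : ℝ → ℝ} (hf : Continuous f) :
    Continuous (angularMoment f) := by
  unfold angularMoment
  apply intervalIntegral.continuous_parametric_intervalIntegral_of_continuous'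
  fun_prop

theorem hasDerivAt_primitive {f : ℝ → ℝ} (hf : Continuous f) (s : ℝ) :
    HasDerivAt (primitive f) (f s) s :=
  intervalIntegral.integral_hasDerivAt_right (hf.intervalIntegrable _ _)
    (hf.stronglyMeasurableAtFilter _ _) hf.continuousAt

theorem continuous_primitive_of_continuous {f : ℝ → ℝ} (hf : Continuous f) :
    Continuous (primitive f) :=
  continuous_iff_continuousAt.2 fun s => (hasDerivAt_primitive hf s).continuousAt

theorem integral_mul_sqrt_one_sub_div {f : ℝ → ℝ} (hf : Continuous f) {s : ℝ} (hs : 0 < s) :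
    ∫ σ in (0 : ℝ)..s, f σ * Real.sqrt (1 - σ ^ 2 / s ^ 2) = s * angularMoment f s := by
  have h := intervalIntegral.integral_comp_mul_deriv (a := 0) (b := Real.pi / 2)
    (f := fun θ => s * Real.sin θ) (f' := fun θ => s * Real.cos θ)
    (g := fun σ => f σ * Real.sqrt (1 - σ ^ 2 / s ^ 2))
    (fun θ _ => (Real.hasDerivAt_sin θ).const_mul s) (by fun_prop) (by fun_prop)
  simp only [Real.sin_zero, Real.sin_pi_div_two, mul_zero, mul_one] at h
  rw [← h, angularMoment, ← intervalIntegral.integral_const_mul]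
  refine intervalIntegral.integral_congr fun θ hθ => ?_
  rw [uIcc_of_le (by positivity)] at hθ
  have hc : 0 ≤ Real.cos θ :=
    Real.cos_nonneg_of_mem_Icc ⟨by linarith [hθ.1, Real.pi_pos], hθ.2⟩
  have e : 1 - (s * Real.sin θ) ^ 2 / s ^ 2 = Real.cos θ ^ 2 := by
    rw [Real.cos_sq']
    field_simp
  simp only [Function.comp, e, Real.sqrt_sq hc]
  ring

theorem kappa_eq_angularMoment {f : ℝ → ℝ} (hf : Continuous f) {s : ℝ} (hs : 0 < s) :
    kappa f s = 2 / Real.pi * (s * angularMoment f s) := by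
  rw [kappa, integral_mul_sqrt_one_sub_div hf hs]

theorem kappa_eq_zero_iff {f : ℝ → ℝ} (hf : Continuous f) {s : ℝ} (hs : 0 < s) :
    kappa f s = 0 ↔ angularMoment f s = 0 := by
  rw [kappa_eq_angularMoment hf hs]
  simp [Real.pi_ne_zero, hs.ne']

/-- Integration by parts trades `f` for its primitive, whose sign is known. The boundary terms
vanish because `cos (π/2) = 0` and `F 0 = 0`. -/
theorem mul_angularMoment_eq {f : ℝ → ℝ} (hf : Continuous f) (s : ℝ) :
    s * angularMoment f s
      = ∫ θ in (0 : ℝ)..(Real.pi / 2), primitive f (s * Real.sin θ) * Real.sin θ := by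
  have hF := continuous_primitive_of_continuous hf
  have h := intervalIntegral.integral_mul_deriv_eq_deriv_mul (a := 0) (b := Real.pi / 2)
    (u := fun θ => Real.cos θ) (u' := fun θ => -Real.sin θ)
    (v := fun θ => primitive f (s * Real.sin θ)) (v' := fun θ => f (s * Real.sin θ) * (s * Real.cos θ))
    (fun θ _ => Real.hasDerivAt_cos θ)
    (fun θ _ => (hasDerivAt_primitive hf _).comp θ ((Real.hasDerivAt_sin θ).const_mul s))
    (Continuous.intervalIntegrable (by fun_prop) _ _)
    (Continuous.intervalIntegrable (by fun_prop) _ _)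
  have h0 : primitive f 0 = 0 := by simp [primitive]
  simp only [Real.cos_pi_div_two, Real.sin_zero, mul_zero, zero_mul, h0, sub_zero, zero_sub] at h
  rw [angularMoment, ← intervalIntegral.integral_const_mul]
  calc _ = ∫ θ in (0 : ℝ)..(Real.pi / 2),
        Real.cos θ * (f (s * Real.sin θ) * (s * Real.cos θ)) := by
        congr 1; ext θ; ring
    _ = _ := by
        rw [h, ← intervalIntegral.integral_neg]
        congr 1; ext θ; ring

/-- The factor `s²` turns the weight into `√(s² - σ²)`, which is increasing in `s`; this is the form
suited to monotonicity. -/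
theorem sq_mul_angularMoment_eq {f : ℝ → ℝ} (hf : Continuous f) {s : ℝ} (hs : 0 < s) :
    s ^ 2 * angularMoment f s = ∫ σ in (0 : ℝ)..s, f σ * Real.sqrt (s ^ 2 - σ ^ 2) := by
  rw [sq s, mul_assoc, ← integral_mul_sqrt_one_sub_div hf hs, ← intervalIntegral.integral_const_mul]
  congr 1; ext σ
  have : s ^ 2 - σ ^ 2 = s ^ 2 * (1 - σ ^ 2 / s ^ 2) := by field_simp
  rw [← sq, this, Real.sqrt_mul (sq_nonneg s), Real.sqrt_sq hs.le]
  ring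

theorem nonneg_of_monotoneOn_primitive {f : ℝ → ℝ} (hf : Continuous f) {s₀ : ℝ}
    (hmono : MonotoneOn (primitive f) (Ioi s₀)) {s : ℝ} (hs : s₀ < s) : 0 ≤ f s := by
  have h := hmono.derivWithin_nonneg (x := s)
  rwa [derivWithin_of_isOpen isOpen_Ioi hs, (hasDerivAt_primitive hf s).deriv] at h

theorem angularMoment_neg {f : ℝ → ℝ} (hf : Continuous f) {s₀ : ℝ}
    (hneg : ∀ s ∈ Ioo 0 s₀, primitive f s < 0) {s : ℝ} (hs : 0 < s) (hs₀ : s ≤ s₀) :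
    angularMoment f s < 0 := by
  have hF := continuous_primitive_of_continuous hf
  have h : 0 < ∫ θ in (0 : ℝ)..(Real.pi / 2),
      -(primitive f (s * Real.sin θ) * Real.sin θ) := by
    refine intervalIntegral_pos_of_pos_on (Continuous.intervalIntegrable (by fun_prop) _ _)
      (fun θ hθ => ?_) (by positivity)
    have h1 : 0 < Real.sin θ := Real.sin_pos_of_pos_of_lt_pi hθ.1 (by linarith [hθ.2, Real.pi_pos])
    have h2 : Real.sin θ < 1 := by
      rw [← Real.sin_pi_div_two]
      exact Real.sin_lt_sin_of_lt_of_le_pi_div_two (by linarith [hθ.1, Real.pi_pos]) le_rfl hθ.2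
    have := hneg (s * Real.sin θ) ⟨by positivity, by nlinarith⟩
    nlinarith
  rw [intervalIntegral.integral_neg, ← mul_angularMoment_eq hf] at h
  by_contra hc
  push Not at hc
  nlinarith [mul_nonneg hs.le hc]

/-- Beyond `s₀` monotonicity of `F` gives `f ≥ 0`, so enlarging the weight and the interval does not
decrease the integral. On `[0, s₀]` the sign of `f` is unknown; the strict gain there comes from
integrating by parts. -/
theorem sq_mul_angularMoment_lt {f : ℝ → ℝ} (hf : Continuous f) {s₀ : ℝ} (h0 : 0 < s₀)
    (hF0 : primitive f s₀ = 0) (hneg : ∀ s ∈ Ioo 0 s₀, primitive f s < 0)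
    (hmono : MonotoneOn (primitive f) (Ioi s₀)) {s t : ℝ} (hs : s₀ < s) (hst : s < t) :
    s ^ 2 * angularMoment f s < t ^ 2 * angularMoment f t := by
  have hFc := continuous_primitive_of_continuous hf
  have hspos : 0 < s := h0.trans hs
  rw [sq_mul_angularMoment_eq hf hspos, sq_mul_angularMoment_eq hf (hspos.trans hst)]
  have hi : ∀ r a b : ℝ, IntervalIntegrable (fun σ => f σ * Real.sqrt (r ^ 2 - σ ^ 2)) volume a b :=
    fun r a b => Continuous.intervalIntegrable (by fun_prop) _ _
  rw [← integral_add_adjacent_intervals (hi t 0 s₀) (hi t s₀ t),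
    ← integral_add_adjacent_intervals (hi t s₀ s) (hi t s t),
    ← integral_add_adjacent_intervals (hi s 0 s₀) (hi s s₀ s)]
  have hA : ∫ σ in s₀..s, f σ * Real.sqrt (s ^ 2 - σ ^ 2)
      ≤ ∫ σ in s₀..s, f σ * Real.sqrt (t ^ 2 - σ ^ 2) := by
    refine integral_mono_on_of_le_Ioo hs.le (hi _ _ _) (hi _ _ _) fun σ hσ => ?_
    refine mul_le_mul_of_nonneg_left (Real.sqrt_le_sqrt ?_)
      (nonneg_of_monotoneOn_primitive hf hmono hσ.1)
    nlinarith
  have hB : 0 ≤ ∫ σ in s..t, f σ * Real.sqrt (t ^ 2 - σ ^ 2) := by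
    refine integral_nonneg hst.le fun σ hσ => mul_nonneg
      (nonneg_of_monotoneOn_primitive hf hmono (hs.trans_le hσ.1)) (Real.sqrt_nonneg _)
  -- The boundary terms vanish since `F 0 = F s₀ = 0`. The new kernel `σ / √(r² - σ²)` decreases in
  -- `r` while `F < 0`, so the integral increases in `r`.
  have hparts : ∀ r : ℝ, s₀ < r → ContinuousOn (fun σ => σ / Real.sqrt (r ^ 2 - σ ^ 2)) (uIcc 0 s₀)
      ∧ ∫ σ in (0 : ℝ)..s₀, f σ * Real.sqrt (r ^ 2 - σ ^ 2)
        = ∫ σ in (0 : ℝ)..s₀, primitive f σ * (σ / Real.sqrt (r ^ 2 - σ ^ 2)) := by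
    intro r hr
    have hne : ∀ σ ∈ uIcc 0 s₀, 0 < r ^ 2 - σ ^ 2 := by
      intro σ hσ
      rw [uIcc_of_le h0.le] at hσ
      nlinarith [hσ.1, hσ.2]
    have hcont : ContinuousOn (fun σ => σ / Real.sqrt (r ^ 2 - σ ^ 2)) (uIcc 0 s₀) :=
      ContinuousOn.div (by fun_prop) (by fun_prop)
        fun σ hσ => (Real.sqrt_pos.2 (hne σ hσ)).ne'
    refine ⟨hcont, ?_⟩
    have h := intervalIntegral.integral_mul_deriv_eq_deriv_mul (a := 0) (b := s₀)
      (u := fun σ => Real.sqrt (r ^ 2 - σ ^ 2)) (u' := fun σ => -(σ / Real.sqrt (r ^ 2 - σ ^ 2)))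
      (v := primitive f) (v' := f)
      (fun σ hσ => by
        have h1 : HasDerivAt (fun σ : ℝ => r ^ 2 - σ ^ 2) (-(2 * σ)) σ := by
          simpa using ((hasDerivAt_pow 2 σ).const_sub (r ^ 2))
        refine (h1.sqrt (hne σ hσ).ne').congr_deriv ?_
        rw [neg_div, mul_div_mul_left _ _ two_ne_zero])
      (fun σ _ => hasDerivAt_primitive hf σ)
      hcont.neg.intervalIntegrable
      (hf.intervalIntegrable _ _)
    have hp0 : primitive f 0 = 0 := by simp [primitive]
    simp only [hF0, hp0, mul_zero, sub_zero, zero_sub] at h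
    calc _ = ∫ σ in (0 : ℝ)..s₀, Real.sqrt (r ^ 2 - σ ^ 2) * f σ := by
          congr 1; ext σ; ring
      _ = _ := by
          rw [h, ← intervalIntegral.integral_neg]
          congr 1; ext σ; ring
  have hC : ∫ σ in (0 : ℝ)..s₀, f σ * Real.sqrt (s ^ 2 - σ ^ 2)
      < ∫ σ in (0 : ℝ)..s₀, f σ * Real.sqrt (t ^ 2 - σ ^ 2) := by
    obtain ⟨cs, es⟩ := hparts s hs
    obtain ⟨ct, et⟩ := hparts t (hs.trans hst)
    have is := (hFc.continuousOn.fun_mul cs).intervalIntegrable (μ := volume)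
    have it := (hFc.continuousOn.fun_mul ct).intervalIntegrable (μ := volume)
    rw [es, et, ← sub_pos, ← integral_sub it is]
    refine intervalIntegral_pos_of_pos_on (it.sub is) (fun σ hσ => ?_) h0
    have h1 : Real.sqrt (s ^ 2 - σ ^ 2) < Real.sqrt (t ^ 2 - σ ^ 2) :=
      Real.sqrt_lt_sqrt (by nlinarith [hσ.1, hσ.2]) (by nlinarith)
    have h2 : 0 < Real.sqrt (s ^ 2 - σ ^ 2) := Real.sqrt_pos.2 (by nlinarith [hσ.1, hσ.2])
    have h3 := div_lt_div_of_pos_left hσ.1 h2 h1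
    nlinarith [hneg σ hσ]
  linarith

/-- `F` is bounded below by `-|M|` on `[0, ∞)`. At radius `2 * T` the angles in `[π/6, π/2]` have
`sin θ ≥ 1/2`, so there `F (2 T sin θ) ≥ F T`. The total is at least `(π/6) * (F T - |M|)`, positive
for a suitable `T` because `F` is unbounded. -/
theorem exists_angularMoment_pos {f : ℝ → ℝ} (hf : Continuous f) {s₀ : ℝ} (h0 : 0 < s₀)
    (hpos : ∀ s ∈ Ioi s₀, 0 < primitive f s) (hmono : MonotoneOn (primitive f) (Ioi s₀))
    (hunb : ¬ BddAbove (primitive f '' Ioi s₀)) : ∃ s, s₀ < s ∧ 0 < angularMoment f s := by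
  have hF := continuous_primitive_of_continuous hf
  obtain ⟨M, hM⟩ := (isCompact_Icc (a := 0) (b := s₀)).bddBelow_image hF.continuousOn
  have hlow : ∀ s, 0 ≤ s → -|M| ≤ primitive f s := by
    intro s hs
    rcases le_or_gt s s₀ with h | h
    · exact (neg_abs_le M).trans (hM ⟨s, ⟨hs, h⟩, rfl⟩)
    · linarith [hpos s h, abs_nonneg M]
  obtain ⟨T, hT, hFT⟩ : ∃ T ∈ Ioi s₀, |M| + 1 < primitive f T := by
    by_contra hc
    push Not at hc
    exact hunb ⟨|M| + 1, by rintro _ ⟨T, hT, rfl⟩; exact hc T hT⟩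
  have hTpos : 0 < T := h0.trans hT
  refine ⟨2 * T, by have : s₀ < T := hT; linarith, ?_⟩
  have hi : ∀ a b : ℝ, IntervalIntegrable
      (fun θ => primitive f (2 * T * Real.sin θ) * Real.sin θ) volume a b :=
    fun a b => Continuous.intervalIntegrable (by fun_prop) _ _
  have hpi := Real.pi_pos
  have h1 : -|M| * (Real.pi / 6) ≤
      ∫ θ in (0 : ℝ)..(Real.pi / 6), primitive f (2 * T * Real.sin θ) * Real.sin θ := by
    have := integral_mono_on (a := 0) (b := Real.pi / 6) (by positivity)
      ((continuous_const (y := -|M|)).intervalIntegrable _ _) (hi 0 (Real.pi / 6)) (μ := volume) ?_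
    · simpa [mul_comm] using this
    · intro θ hθ
      have hs : 0 ≤ Real.sin θ := Real.sin_nonneg_of_nonneg_of_le_pi hθ.1 (by linarith [hθ.2])
      have := hlow (2 * T * Real.sin θ) (by positivity)
      nlinarith [Real.sin_le_one θ, abs_nonneg M]
  have h2 : (primitive f T / 2) * (Real.pi / 2 - Real.pi / 6) ≤
      ∫ θ in (Real.pi / 6)..(Real.pi / 2), primitive f (2 * T * Real.sin θ) * Real.sin θ := by
    have := integral_mono_on (a := Real.pi / 6) (b := Real.pi / 2) (by linarith)
      ((continuous_const (y := primitive f T / 2)).intervalIntegrable _ _) (hi _ _) (μ := volume) ?_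
    · rwa [intervalIntegral.integral_const, smul_eq_mul, mul_comm] at this
    · intro θ hθ
      have hs : 1 / 2 ≤ Real.sin θ := by
        rw [← Real.sin_pi_div_six]
        exact Real.sin_le_sin_of_le_of_le_pi_div_two (by linarith) hθ.2 hθ.1
      have h3 : T ≤ 2 * T * Real.sin θ := by nlinarith
      have h4 := hmono hT (lt_of_lt_of_le hT h3) h3
      have h5 := abs_nonneg M
      nlinarith
  have h3 : 0 < 2 * T * angularMoment f (2 * T) := by
    rw [mul_angularMoment_eq hf, ← integral_add_adjacent_intervals (hi 0 (Real.pi / 6)) (hi _ _)]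
    nlinarith
  exact pos_of_mul_pos_right h3 (by positivity)

theorem exists_angularMoment_zero {f : ℝ → ℝ} (hf : Continuous f)
    (hF : LienardSign (primitive f)) :
    ∃ ρ : ℝ, 0 < ρ ∧ angularMoment f ρ = 0 ∧ (∀ s, 0 < s → s < ρ → angularMoment f s < 0) ∧
      ∀ s, ρ < s → 0 < angularMoment f s := by
  obtain ⟨s₀, h0, hF0, hneg, hpos, hmono, hunb⟩ := hF
  obtain ⟨S, hS, hAS⟩ := exists_angularMoment_pos hf h0 hpos hmono hunb
  have hA0 := angularMoment_neg hf hneg h0 le_rfl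
  obtain ⟨ρ, hρ, hz⟩ := intermediate_value_Ioo hS.le (continuous_angularMoment hf).continuousOn
    (show (0 : ℝ) ∈ Ioo _ _ from ⟨hA0, hAS⟩)
  have hlt := fun {s t : ℝ} => sq_mul_angularMoment_lt hf h0 hF0 hneg hmono (s := s) (t := t)
  refine ⟨ρ, h0.trans hρ.1, hz, fun s hs hsρ => ?_, fun s hs => ?_⟩
  · rcases le_or_gt s s₀ with h | h
    · exact angularMoment_neg hf hneg hs h
    · have := hlt h hsρ
      rw [hz, mul_zero] at this
      exact neg_of_mul_neg_right this (sq_nonneg s)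
  · have := hlt hρ.1 hs
    rw [hz, mul_zero] at this
    exact pos_of_mul_pos_right this (sq_nonneg s)

theorem existsUnique_kappa_eq_zero {f : ℝ → ℝ} (hf : Continuous f)
    (hF : LienardSign (primitive f)) : ∃! ρ : ℝ, 0 < ρ ∧ kappa f ρ = 0 := by
  obtain ⟨ρ, h0, hz, hneg, hpos⟩ := exists_angularMoment_zero hf hF
  refine ⟨ρ, ⟨h0, (kappa_eq_zero_iff hf h0).2 hz⟩, fun s ⟨hs, hks⟩ => ?_⟩
  rw [kappa_eq_zero_iff hf hs] at hks
  rcases lt_trichotomy s ρ with h | h | h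
  · exact absurd hks (hneg s hs h).ne
  · exact h
  · exact absurd hks (hpos s h).ne'

theorem angularMoment_pos_of_kappa_eq_zero {f : ℝ → ℝ} (hf : Continuous f)
    (hF : LienardSign (primitive f)) {ρ : ℝ} (hρ : 0 < ρ) (hk : kappa f ρ = 0) {s : ℝ}
    (hs : ρ < s) : 0 < angularMoment f s := by
  obtain ⟨r, h0, hz, -, hpos⟩ := exists_angularMoment_zero hf hF
  have : ρ = r := (existsUnique_kappa_eq_zero hf hF).unique ⟨hρ, hk⟩
    ⟨h0, (kappa_eq_zero_iff hf h0).2 hz⟩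
  exact hpos s (this ▸ hs)

end

/-! ### Damping and coupling averaged over one turn -/

section

open MeasureTheory Set intervalIntegral

theorem exists_polar (y : Plane) :
    ∃ ψ : ℝ, y 0 = ‖y‖ * Real.cos ψ ∧ y 1 = ‖y‖ * Real.sin ψ := by
  have hn : ‖y‖ = ‖(⟨y 0, y 1⟩ : ℂ)‖ := by
    rw [EuclideanSpace.norm_eq, Complex.norm_def, Complex.normSq_apply]
    simp [Fin.sum_univ_two, sq]
  refine ⟨Complex.arg ⟨y 0, y 1⟩, ?_, ?_⟩
  · rw [hn, Complex.norm_mul_cos_arg]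
  · rw [hn, Complex.norm_mul_sin_arg]

theorem positionRow_sq_add_velocityRow_sq (φ : ℝ) (y : Plane) :
    positionRow φ y ^ 2 + velocityRow φ y ^ 2 = ‖y‖ ^ 2 := by
  rw [EuclideanSpace.real_norm_sq_eq, Fin.sum_univ_two, positionRow, velocityRow]
  linear_combination (y 0 ^ 2 + y 1 ^ 2) * Real.sin_sq_add_cos_sq φ

theorem abs_velocityRow_le (φ : ℝ) (y : Plane) : |velocityRow φ y| ≤ ‖y‖ :=
  have h := positionRow_sq_add_velocityRow_sq φ y
  abs_le_of_sq_le_sq (by nlinarith [sq_nonneg (positionRow φ y)]) (norm_nonneg y)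

theorem continuous_positionRow (y : Plane) : Continuous fun φ => positionRow φ y := by
  unfold positionRow; fun_prop

theorem continuous_velocityRow (y : Plane) : Continuous fun φ => velocityRow φ y := by
  unfold velocityRow; fun_prop

theorem hasDerivAt_velocityRow (φ : ℝ) (y : Plane) :
    HasDerivAt (fun φ => velocityRow φ y) (-positionRow φ y) φ := by
  unfold velocityRow positionRow
  refine (((Real.hasDerivAt_sin φ).neg.mul_const (y 0)).add
    ((Real.hasDerivAt_cos φ).mul_const (y 1))).congr_deriv ?_
  ring

/-- In polar coordinates the position and velocity rows are `p sin θ` and `p cos θ` for a shifted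
angle `θ`. Evenness of `f` makes the integrand even and `π`-periodic, so a turn is four quarter
turns. -/
theorem integral_damping {f : ℝ → ℝ} (hf : Continuous f) (hf_even : Function.Even f) (y : Plane) :
    ∫ φ in (0 : ℝ)..(2 * Real.pi), f (positionRow φ y) * velocityRow φ y ^ 2
      = 4 * (‖y‖ ^ 2 * angularMoment f ‖y‖) := by
  obtain ⟨ψ, h0, h1⟩ := exists_polar y
  set p := ‖y‖
  set k : ℝ → ℝ := fun θ => f (p * Real.sin θ) * Real.cos θ ^ 2 with hk
  have hkc : Continuous k := by fun_prop
  have hki : ∀ a b : ℝ, IntervalIntegrable k volume a b := hkc.intervalIntegrable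
  have hper : Function.Periodic k Real.pi := fun θ => by
    simp only [hk, Real.sin_add_pi, Real.cos_add_pi, mul_neg, hf_even _]
    ring
  have hpt : ∀ φ, f (positionRow φ y) * velocityRow φ y ^ 2
      = p ^ 2 * k (φ + (Real.pi / 2 - ψ)) := fun φ => by
    have e1 : positionRow φ y = p * Real.sin (φ + (Real.pi / 2 - ψ)) := by
      rw [show φ + (Real.pi / 2 - ψ) = (φ - ψ) + Real.pi / 2 by ring, Real.sin_add_pi_div_two,
        Real.cos_sub, positionRow, h0, h1]
      ring
    have e2 : velocityRow φ y = p * Real.cos (φ + (Real.pi / 2 - ψ)) := by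
      rw [show φ + (Real.pi / 2 - ψ) = (φ - ψ) + Real.pi / 2 by ring, Real.cos_add_pi_div_two,
        Real.sin_sub, velocityRow, h0, h1]
      ring
    rw [e1, e2, hk]
    ring
  have hhalf : ∫ θ in -(Real.pi / 2)..(Real.pi / 2), k θ = 2 * angularMoment f p := by
    rw [← integral_add_adjacent_intervals (hki _ 0) (hki _ _)]
    have : ∫ θ in -(Real.pi / 2)..0, k θ = ∫ θ in (0 : ℝ)..(Real.pi / 2), k θ := by
      have := intervalIntegral.integral_comp_neg (a := 0) (b := Real.pi / 2) k
      rw [neg_zero] at this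
      rw [← this]
      congr 1; ext θ
      simp only [hk, Real.sin_neg, Real.cos_neg, mul_neg, hf_even _]
    rw [this, ← two_mul, angularMoment]
  simp_rw [hpt]
  rw [intervalIntegral.integral_const_mul, intervalIntegral.integral_comp_add_right]
  have hper2 := hper.intervalIntegral_add_eq
  set c := Real.pi / 2 - ψ
  rw [show (0 : ℝ) + c = c by ring, show 2 * Real.pi + c = c + Real.pi + Real.pi by ring,
    ← integral_add_adjacent_intervals (hki _ (c + Real.pi)) (hki _ _), hper2 c (-(Real.pi / 2)),
    hper2 (c + Real.pi) (-(Real.pi / 2)), show -(Real.pi / 2) + Real.pi = Real.pi / 2 by ring,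
    hhalf]
  ring

/-- Split `y` into components along and across `z`. The cross term contains `g (w·z) * (u·z)`, minus
the phase derivative of the primitive of `g` at `w·z`, and integrates to zero over a turn. What
remains is `⟪z, y⟫` times a nonnegative integral of size at most `2πK‖z‖²`. -/
theorem integral_coupling_le {g : ℝ → ℝ} (hg : Continuous g) (hg0 : g 0 = 0)
    (hgs : ∀ s, 0 ≤ s * g s) {K d : ℝ} (hK : 0 ≤ K) (hd : 0 ≤ d) {y z : Plane}
    (hgK : ∀ s, |s| ≤ ‖z‖ → |g s| ≤ K * |s|) (hyz : inner ℝ z y ≤ d) :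
    ∫ φ in (0 : ℝ)..(2 * Real.pi), g (velocityRow φ z) * velocityRow φ y
      ≤ 2 * Real.pi * (K * d) := by
  have hpi := Real.pi_pos
  rcases eq_or_ne z 0 with rfl | hz
  · have : ∀ φ, g (velocityRow φ 0) * velocityRow φ y = 0 := fun φ => by
      simp [velocityRow, hg0]
    simp only [this, intervalIntegral.integral_zero]
    positivity
  have hwz := continuous_velocityRow z
  have huz := continuous_positionRow z
  have hz2 : 0 < ‖z‖ ^ 2 := by positivity
  have horth : ∫ φ in (0 : ℝ)..(2 * Real.pi), g (velocityRow φ z) * positionRow φ z = 0 := by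
    have h := intervalIntegral.integral_eq_sub_of_hasDerivAt (a := 0) (b := 2 * Real.pi)
      (f := fun φ => primitive g (velocityRow φ z))
      (f' := fun φ => g (velocityRow φ z) * -positionRow φ z)
      (fun φ _ => (hasDerivAt_primitive hg _).comp φ (hasDerivAt_velocityRow φ z))
      (Continuous.intervalIntegrable (by fun_prop) _ _)
    have e : velocityRow (2 * Real.pi) z = velocityRow 0 z := by simp [velocityRow]
    rw [e, sub_self] at h
    simpa using h
  have hsq : ∀ φ, ‖z‖ ^ 2 * (g (velocityRow φ z) * velocityRow φ y)
      = inner ℝ z y * (g (velocityRow φ z) * velocityRow φ z)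
        + (z 0 * y 1 - z 1 * y 0) * (g (velocityRow φ z) * positionRow φ z) := fun φ => by
    rw [EuclideanSpace.real_norm_sq_eq, Fin.sum_univ_two, PiLp.inner_apply, Fin.sum_univ_two]
    simp only [velocityRow, positionRow, RCLike.inner_apply, conj_trivial]
    ring
  have hint : ‖z‖ ^ 2 * ∫ φ in (0 : ℝ)..(2 * Real.pi), g (velocityRow φ z) * velocityRow φ y
      = inner ℝ z y * ∫ φ in (0 : ℝ)..(2 * Real.pi), g (velocityRow φ z) * velocityRow φ z := by
    rw [← intervalIntegral.integral_const_mul]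
    simp_rw [hsq]
    rw [intervalIntegral.integral_add (Continuous.intervalIntegrable (by fun_prop) _ _)
      (Continuous.intervalIntegrable (by fun_prop) _ _), intervalIntegral.integral_const_mul,
      intervalIntegral.integral_const_mul, horth, mul_zero, add_zero]
  have hI0 : 0 ≤ ∫ φ in (0 : ℝ)..(2 * Real.pi), g (velocityRow φ z) * velocityRow φ z :=
    intervalIntegral.integral_nonneg (by positivity) fun φ _ => by
      rw [mul_comm]; exact hgs _
  have hI1 : ∫ φ in (0 : ℝ)..(2 * Real.pi), g (velocityRow φ z) * velocityRow φ z
      ≤ 2 * Real.pi * (K * ‖z‖ ^ 2) := by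
    have := intervalIntegral.integral_mono_on (a := 0) (b := 2 * Real.pi) (μ := volume)
      (f := fun φ => g (velocityRow φ z) * velocityRow φ z) (g := fun _ => K * ‖z‖ ^ 2)
      (by positivity) (Continuous.intervalIntegrable (by fun_prop) _ _)
      (continuous_const.intervalIntegrable _ _) fun φ _ => by
        have h1 := abs_velocityRow_le φ z
        calc g (velocityRow φ z) * velocityRow φ z
            ≤ |g (velocityRow φ z)| * |velocityRow φ z| := by
              rw [← abs_mul]; exact le_abs_self _
          _ ≤ K * |velocityRow φ z| * |velocityRow φ z| := by
              gcongr; exact hgK _ h1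
          _ ≤ K * ‖z‖ * ‖z‖ := by gcongr
          _ = K * ‖z‖ ^ 2 := by ring
    rwa [intervalIntegral.integral_const, smul_eq_mul, sub_zero] at this
  refine le_of_mul_le_mul_left ?_ hz2
  rw [hint]
  calc _ ≤ d * ∫ φ in (0 : ℝ)..(2 * Real.pi), g (velocityRow φ z) * velocityRow φ z := by gcongr
    _ ≤ d * (2 * Real.pi * (K * ‖z‖ ^ 2)) := by gcongr
    _ = _ := by ring

theorem inner_velocityCol (y : Plane) (φ : ℝ) :
    inner ℝ y (velocityCol φ) = velocityRow φ y := by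
  rw [PiLp.inner_apply, Fin.sum_univ_two]
  simp [velocityCol, velocityRow]

theorem inner_rotatedField {m : ℕ} (f : ℝ → ℝ) (γ : Fin m → Fin m → ℝ → ℝ) (x : State m) (φ : ℝ)
    (i : Fin m) :
    inner ℝ (x i) (rotatedField f γ x φ i)
      = -(f (positionRow φ (x i)) * velocityRow φ (x i) ^ 2)
        + ∑ j ∈ Finset.univ.erase i, γ i j (velocityRow φ (x j - x i)) * velocityRow φ (x i) := by
  simp only [rotatedField, rotatedBlock, inner_add_right, inner_neg_right, inner_smul_right,
    inner_sum, inner_velocityCol]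
  ring

theorem integral_inner_rotatedField_le {m : ℕ} {f : ℝ → ℝ} {γ : Fin m → Fin m → ℝ → ℝ}
    (hf : Continuous f) (hf_even : Function.Even f)
    (hγc : ∀ i j : Fin m, i ≠ j → Continuous (γ i j)) (hγ : IsInterconnection γ)
    {v K : ℝ} (hK : 0 ≤ K) (hγK : ∀ i j : Fin m, i ≠ j → ∀ s, |s| ≤ 2 * v → |γ i j s| ≤ K * |s|)
    {x : State m} (hx : x ∈ discProduct m v) (i : Fin m) :
    ∫ φ in (0 : ℝ)..(2 * Real.pi), inner ℝ (x i) (rotatedField f γ x φ i)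
      ≤ -(4 * (‖x i‖ ^ 2 * angularMoment f ‖x i‖))
        + m * (2 * Real.pi * (K * (‖x i‖ * (v - ‖x i‖)))) := by
  have hw := fun y : Plane => continuous_velocityRow y
  have hu := fun y : Plane => continuous_positionRow y
  have hd : 0 ≤ ‖x i‖ * (v - ‖x i‖) := mul_nonneg (norm_nonneg _) (sub_nonneg.2 (hx i))
  have hcoup : ∀ j ∈ Finset.univ.erase i,
      Continuous fun φ => γ i j (velocityRow φ (x j - x i)) * velocityRow φ (x i) :=
    fun j hj => ((hγc i j (Finset.ne_of_mem_erase hj).symm).comp (hw _)).mul (hw _)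
  simp_rw [inner_rotatedField]
  rw [intervalIntegral.integral_add
    (Continuous.intervalIntegrable (by have := hw (x i); have := hu (x i); fun_prop) _ _)
    (Continuous.intervalIntegrable (continuous_finsetSum _ hcoup) _ _),
    intervalIntegral.integral_neg, integral_damping hf hf_even,
    intervalIntegral.integral_finsetSum fun j hj =>
      (hcoup j hj).intervalIntegrable _ _]
  refine add_le_add le_rfl ?_
  calc _ ≤ ∑ j ∈ Finset.univ.erase i, 2 * Real.pi * (K * (‖x i‖ * (v - ‖x i‖))) := by
        refine Finset.sum_le_sum fun j hj => ?_
        have hij := (Finset.ne_of_mem_erase hj).symm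
        refine integral_coupling_le (hγc i j hij) (hγ i j hij).1.1 (hγ i j hij).1.2 hK hd
          (fun s hs => hγK i j hij s (hs.trans ?_)) ?_
        · linarith [norm_sub_le (x j) (x i), hx i, hx j]
        -- Here `⟪x j - x i, x i⟫ ≤ v ‖x i‖ - ‖x i‖²`, by Cauchy–Schwarz and `‖x j‖ ≤ v`.
        · rw [inner_sub_left, real_inner_self_eq_norm_sq]
          nlinarith [real_inner_le_norm (x j) (x i), hx j, norm_nonneg (x i)]
    _ ≤ _ := by
        rw [Finset.sum_const, nsmul_eq_mul]
        have := Real.pi_pos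
        gcongr
        exact (Finset.card_le_univ _).trans (by simp)

end

/-! ### Regularity and bounds of the rotated field on products of discs -/

section

open Set

theorem norm_state_le_sum {m : ℕ} (x : State m) : ‖x‖ ≤ ∑ i, ‖x i‖ := by
  rw [PiLp.norm_eq_of_L2]
  refine Real.sqrt_le_iff.2 ⟨Finset.sum_nonneg fun i _ => norm_nonneg _, ?_⟩
  exact Finset.sum_sq_le_sq_sum_of_nonneg fun i _ => norm_nonneg _

theorem norm_le_of_mem_discProduct {m : ℕ} {R : ℝ} {x : State m} (hx : x ∈ discProduct m R) :
    ‖x‖ ≤ m * R := by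
  refine (norm_state_le_sum x).trans ((Finset.sum_le_sum fun i _ => hx i).trans ?_)
  simp

theorem discProduct_mono {m : ℕ} {v w : ℝ} (h : v ≤ w) : discProduct m v ⊆ discProduct m w :=
  fun _ hx i => (hx i).trans h

theorem mem_discProduct_of_norm_sub_le {m : ℕ} {v d : ℝ} {x y : State m}
    (hx : x ∈ discProduct m v) (h : ‖y - x‖ ≤ d) : y ∈ discProduct m (v + d) := fun i => by
  have h1 : ‖(y - x) i‖ ≤ ‖y - x‖ := PiLp.norm_apply_le _ i
  have h2 : y i = x i + (y - x) i := by simp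
  rw [h2]
  exact (norm_add_le _ _).trans (add_le_add (hx i) (h1.trans h))

theorem isClosed_discProduct (m : ℕ) (R : ℝ) : IsClosed (discProduct m R) := by
  simp only [discProduct, ofPred_forall]
  exact isClosed_iInter fun i => isClosed_le (by fun_prop) continuous_const

theorem isCompact_discProduct (m : ℕ) (R : ℝ) : IsCompact (discProduct m R) :=
  Metric.isCompact_of_isClosed_isBounded (isClosed_discProduct m R)
    ((Metric.isBounded_closedBall (x := 0) (r := m * R)).subset fun x hx => by
      simpa using norm_le_of_mem_discProduct hx)

theorem locallyLipschitz_smul {X E : Type*} [PseudoEMetricSpace X] [NormedAddCommGroup E]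
    [NormedSpace ℝ E] {a : X → ℝ} {b : X → E} (ha : LocallyLipschitz a) (hb : LocallyLipschitz b) :
    LocallyLipschitz fun x => a x • b x :=
  (ContDiff.locallyLipschitz (𝕂 := ℝ) (f := fun q : ℝ × E => q.1 • q.2) (by fun_prop)).comp
    (ha.prodMk hb)

theorem locallyLipschitz_finsetSum {X E ι : Type*} [PseudoEMetricSpace X] [NormedAddCommGroup E]
    (s : Finset ι) {a : ι → X → E} (ha : ∀ i ∈ s, LocallyLipschitz (a i)) :
    LocallyLipschitz fun x => ∑ i ∈ s, a i x := by
  classical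
  induction s using Finset.induction_on with
  | empty => simpa using LocallyLipschitz.const 0
  | insert i s hi ih =>
    simp only [Finset.sum_insert hi]
    exact (ha i (Finset.mem_insert_self i s)).add
      (ih fun j hj => ha j (Finset.mem_insert_of_mem hj))

theorem locallyLipschitz_rotatedBlock {m : ℕ} {f : ℝ → ℝ} {γ : Fin m → Fin m → ℝ → ℝ}
    (hf : LocallyLipschitz f) (hγ : ∀ i j : Fin m, i ≠ j → LocallyLipschitz (γ i j)) (i : Fin m) :
    LocallyLipschitz fun p : State m × ℝ => rotatedBlock f γ p.1 p.2 i := by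
  have hcol : LocallyLipschitz fun p : State m × ℝ => velocityCol p.2 := by
    refine ContDiff.locallyLipschitz (𝕂 := ℝ) ?_
    unfold velocityCol
    rw [contDiff_euclidean]
    intro k
    fin_cases k <;> simp <;> fun_prop
  have hpos : LocallyLipschitz fun p : State m × ℝ => positionRow p.2 (p.1 i) := by
    refine ContDiff.locallyLipschitz (𝕂 := ℝ) ?_
    unfold positionRow; fun_prop
  have hvel : LocallyLipschitz fun p : State m × ℝ => velocityRow p.2 (p.1 i) := by
    refine ContDiff.locallyLipschitz (𝕂 := ℝ) ?_
    unfold velocityRow; fun_prop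
  have hdif : ∀ j, LocallyLipschitz fun p : State m × ℝ => velocityRow p.2 (p.1 j - p.1 i) := by
    intro j
    refine ContDiff.locallyLipschitz (𝕂 := ℝ) ?_
    unfold velocityRow
    simp only [PiLp.sub_apply]
    fun_prop
  unfold rotatedBlock
  refine LocallyLipschitz.add (LocallyLipschitz.neg ?_) (locallyLipschitz_finsetSum _ fun j hj => ?_)
  · exact locallyLipschitz_smul (locallyLipschitz_smul (hf.comp hpos) hvel) hcol
  · exact locallyLipschitz_smul
      ((hγ i j (Finset.ne_of_mem_erase hj).symm).comp (hdif j)) hcol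

theorem continuous_rotatedField {m : ℕ} {f : ℝ → ℝ} {γ : Fin m → Fin m → ℝ → ℝ}
    (hf : LocallyLipschitz f) (hγ : ∀ i j : Fin m, i ≠ j → LocallyLipschitz (γ i j)) :
    Continuous fun p : State m × ℝ => rotatedField f γ p.1 p.2 :=
  (PiLp.continuous_toLp 2 _).comp
    (continuous_pi fun i => (locallyLipschitz_rotatedBlock hf hγ i).continuous)

theorem rotatedField_periodic {m : ℕ} (f : ℝ → ℝ) (γ : Fin m → Fin m → ℝ → ℝ) (x : State m) :
    Function.Periodic (rotatedField f γ x) (2 * Real.pi) := fun φ => by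
  simp [rotatedField, rotatedBlock, positionRow, velocityRow, velocityCol]

theorem rotatedField_zero {m : ℕ} (f : ℝ → ℝ) {γ : Fin m → Fin m → ℝ → ℝ}
    (hγ : IsInterconnection γ) (φ : ℝ) : rotatedField f γ 0 φ = 0 := by
  ext1 i
  have : ∀ j ∈ Finset.univ.erase i, γ i j 0 • velocityCol φ = 0 := fun j hj => by
    rw [(hγ i j (Finset.ne_of_mem_erase hj).symm).1.1, zero_smul]
  have h0 : ∀ k, velocityRow φ ((0 : State m) k) = 0 := by simp [velocityRow]
  have h1 : ∀ k, velocityRow φ ((0 : State m) k - (0 : State m) i) = 0 := by simp [velocityRow]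
  change rotatedBlock f γ 0 φ i = 0
  rw [rotatedBlock]
  simp only [h0, h1]
  rw [Finset.sum_eq_zero this]
  simp

/-- Periodicity reduces the phase to the compact interval `[0, 2π]`, which makes the constant
uniform in `φ`. -/
theorem exists_lipschitzOnWith_rotatedField {m : ℕ} {f : ℝ → ℝ} {γ : Fin m → Fin m → ℝ → ℝ}
    (hf : LocallyLipschitz f) (hγ : ∀ i j : Fin m, i ≠ j → LocallyLipschitz (γ i j)) (R : ℝ) :
    ∃ L : ℝ≥0, ∀ φ, LipschitzOnWith L (fun x => rotatedField f γ x φ) (discProduct m R) := by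
  have h := fun i => ((locallyLipschitz_rotatedBlock hf hγ i).locallyLipschitzOn
    (s := discProduct m R ×ˢ Icc 0 (2 * Real.pi))).exists_lipschitzOnWith_of_compact
      ((isCompact_discProduct m R).prod isCompact_Icc)
  choose L hL using h
  refine ⟨∑ i, L i, fun φ => LipschitzOnWith.of_dist_le_mul fun x hx y hy => ?_⟩
  obtain ⟨ψ, hψ, hx', hy'⟩ : ∃ ψ ∈ Icc 0 (2 * Real.pi),
      rotatedField f γ x φ = rotatedField f γ x ψ ∧ rotatedField f γ y φ = rotatedField f γ y ψ := by
    refine ⟨toIcoMod Real.two_pi_pos 0 φ, ?_, ?_, ?_⟩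
    · have := toIcoMod_mem_Ico Real.two_pi_pos 0 φ
      rw [zero_add] at this
      exact Ico_subset_Icc_self this
    · exact ((rotatedField_periodic f γ x).sub_zsmul_eq _).symm
    · exact ((rotatedField_periodic f γ y).sub_zsmul_eq _).symm
  rw [hx', hy', dist_eq_norm]
  refine (norm_state_le_sum _).trans ?_
  push_cast
  rw [Finset.sum_mul]
  refine Finset.sum_le_sum fun i _ => ?_
  have := (hL i).dist_le_mul (x, ψ) ⟨hx, hψ⟩ (y, ψ) ⟨hy, hψ⟩
  simpa [dist_eq_norm, rotatedField, Prod.norm_def] using this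

theorem norm_rotatedField_le {m : ℕ} {f : ℝ → ℝ} {γ : Fin m → Fin m → ℝ → ℝ}
    (hγ : IsInterconnection γ) {R : ℝ} {L : ℝ≥0} (hR : 0 ≤ R) {φ : ℝ}
    (hL : LipschitzOnWith L (fun x => rotatedField f γ x φ) (discProduct m R)) {x : State m}
    (hx : x ∈ discProduct m R) : ‖rotatedField f γ x φ‖ ≤ L * (m * R) := by
  have h0 : (0 : State m) ∈ discProduct m R := fun i => by simpa using hR
  have h := hL.dist_le_mul x hx 0 h0
  rw [dist_eq_norm, dist_eq_norm, rotatedField_zero f hγ, sub_zero, sub_zero] at h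
  exact h.trans (mul_le_mul_of_nonneg_left (norm_le_of_mem_discProduct hx) L.2)

theorem exists_linear_bound_interconnection {m : ℕ} {γ : Fin m → Fin m → ℝ → ℝ}
    (hγ_lip : ∀ i j : Fin m, i ≠ j → LocallyLipschitz (γ i j)) (hγ : IsInterconnection γ) (r : ℝ) :
    ∃ K : ℝ, 0 ≤ K ∧ ∀ i j : Fin m, i ≠ j → ∀ s, |s| ≤ r → |γ i j s| ≤ K * |s| := by
  have h : ∀ i j : Fin m, ∃ K : ℝ≥0, i ≠ j → ∀ s, |s| ≤ r → |γ i j s| ≤ K * |s| := by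
    intro i j
    by_cases hij : i = j
    · exact ⟨0, fun h => absurd hij h⟩
    · obtain ⟨K, hK⟩ := ((hγ_lip i j hij).locallyLipschitzOn
        (s := Icc (-r) r)).exists_lipschitzOnWith_of_compact isCompact_Icc
      refine ⟨K, fun _ s hs => ?_⟩
      have hr := (abs_nonneg s).trans hs
      have := hK.dist_le_mul s (abs_le.1 hs) 0 ⟨by linarith, hr⟩
      simpa [Real.dist_eq, (hγ i j hij).1.1] using this
  choose K hK using h
  refine ⟨∑ p : Fin m × Fin m, (K p.1 p.2 : ℝ), Finset.sum_nonneg fun p _ => (K p.1 p.2).2,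
    fun i j hij s hs => (hK i j hij s hs).trans ?_⟩
  refine mul_le_mul_of_nonneg_right ?_ (abs_nonneg s)
  exact Finset.single_le_sum (f := fun p : Fin m × Fin m => (K p.1 p.2 : ℝ))
    (fun p _ => (K p.1 p.2).2) (Finset.mem_univ (i, j))

end

/-! ### Displacement, gluing and global existence of solutions -/

section

open Set

variable {E : Type*} [NormedAddCommGroup E] [NormedSpace ℝ E]

theorem IsSolutionOn.mono {g : E → ℝ → ℝ → E} {ω : ℝ} {I J : Set ℝ} {x : ℝ → E}
    (hx : IsSolutionOn g ω I x) (hJ : J ⊆ I) : IsSolutionOn g ω J x :=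
  fun t ht => (hx t (hJ ht)).mono hJ

theorem IsSolutionOn.continuousOn {g : E → ℝ → ℝ → E} {ω : ℝ} {I : Set ℝ} {x : ℝ → E}
    (hx : IsSolutionOn g ω I x) : ContinuousOn x I :=
  fun t ht => (hx t ht).continuousWithinAt

/-- A barrier argument: while the displacement is on the line `C * (r - s) ≤ 1`, the state is in the
unit ball where the strict bound on `g` applies, so the line is never crossed. -/
theorem IsSolutionOn.norm_sub_le {g : E → ℝ → ℝ → E} {ω s t C : ℝ} {x : ℝ → E}
    (hx : IsSolutionOn g ω (Icc s t) x)
    (hg : ∀ r, ∀ z, ‖z - x s‖ ≤ 1 → ‖g z ω r‖ < C) (hC : C * (t - s) ≤ 1) {r : ℝ}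
    (hr : r ∈ Icc s t) : ‖x r - x s‖ ≤ C * (r - s) := by
  have hC0 : 0 < C := (norm_nonneg _).trans_lt (hg s (x s) (by simp))
  refine image_norm_le_of_norm_deriv_right_lt_deriv_boundary (a := s) (b := t)
    (f := fun r => x r - x s) (f' := fun r => g (x r) ω r)
    (B := fun r => C * (r - s)) (B' := fun _ => C)
    (hx.continuousOn.sub continuousOn_const) (fun r hr => ?_) (by simp)
    (fun r => by simpa using ((hasDerivAt_id r).sub_const s).const_mul C) (fun r hr he => ?_) hr
  · refine ((hx r (Ico_subset_Icc_self hr)).sub_const (x s)).mono_of_mem_nhdsWithin ?_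
    exact Icc_mem_nhdsGE_of_mem hr
  · refine hg r _ ?_
    rw [he]
    exact (mul_le_mul_of_nonneg_left (by linarith [hr.2]) hC0.le).trans hC

theorem IsSolutionOn.glue {g : E → ℝ → ℝ → E} {ω a b c : ℝ} {x y : ℝ → E} (hab : a ≤ b)
    (hbc : b ≤ c) (hx : IsSolutionOn g ω (Icc a b) x) (hy : IsSolutionOn g ω (Icc b c) y)
    (hxy : x b = y b) : IsSolutionOn g ω (Icc a c) fun t => if t ≤ b then x t else y t := by
  set z : ℝ → E := fun t => if t ≤ b then x t else y t with hz
  have hzx : ∀ t ∈ Icc a b, z t = x t := fun t ht => if_pos ht.2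
  have hzy : ∀ t ∈ Icc b c, z t = y t := fun t ht => by
    rcases ht.1.eq_or_lt with rfl | h
    · simp [hz, hxy]
    · exact if_neg h.not_ge
  intro t ht
  rw [← Icc_union_Icc_eq_Icc hab hbc]
  refine HasDerivWithinAt.union ?_ ?_
  · by_cases h : t ∈ Icc a b
    · rw [hzx t h]
      exact (hx t h).congr hzx (hzx t h)
    · exact HasFDerivWithinAt.of_notMem_closure (by rwa [isClosed_Icc.closure_eq])
  · by_cases h : t ∈ Icc b c
    · rw [hzy t h]
      exact (hy t h).congr hzy (hzy t h)
    · exact HasFDerivWithinAt.of_notMem_closure (by rwa [isClosed_Icc.closure_eq])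

theorem exists_isSolutionOn_Icc [CompleteSpace E] {g : E → ℝ → ℝ → E} {ω τ : ℝ} {L C : ℝ≥0} {x₀ : E}
    (hg : ∀ z, Continuous fun t => g z ω t)
    (hL : ∀ t, LipschitzOnWith L (fun z => g z ω t) (Metric.closedBall x₀ 1))
    (hC : ∀ t, ∀ z ∈ Metric.closedBall x₀ 1, ‖g z ω t‖ ≤ C) (hτ : 0 ≤ τ) (hCτ : C * τ ≤ 1)
    (s : ℝ) : ∃ x : ℝ → E, x s = x₀ ∧ IsSolutionOn g ω (Icc s (s + τ)) x := by
  have hpl : IsPicardLindelof (fun t z => g z ω t)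
      (⟨s, left_mem_Icc.2 (le_add_of_nonneg_right hτ)⟩ : Icc s (s + τ)) x₀ 1 0 C L :=
    { lipschitzOnWith := fun t _ => hL t
      continuousOn := fun z _ => (hg z).continuousOn
      norm_le := fun t _ z hz => hC t z hz
      mul_max_le := by simpa [hτ] using hCτ }
  exact hpl.exists_eq_forall_mem_Icc_hasDerivWithinAt₀

/-- The step `τ` is the same at every point of `S`, so pieces of length `τ` can be glued
indefinitely. Invariance of `S` is needed only at multiples of `τ`. -/
theorem exists_isSolutionOn_Ici {g : E → ℝ → ℝ → E} {ω τ : ℝ} {S : Set E} (hτ : 0 < τ)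
    (hex : ∀ s, ∀ y ∈ S, ∃ x : ℝ → E, x s = y ∧ IsSolutionOn g ω (Icc s (s + τ)) x)
    (hinv : ∀ (s : ℝ) (x : ℝ → E), IsSolutionOn g ω (Icc s (s + τ)) x → x s ∈ S → x (s + τ) ∈ S)
    (t₀ : ℝ) {x₀ : E} (hx₀ : x₀ ∈ S) :
    ∃ x : ℝ → E, x t₀ = x₀ ∧ IsSolutionOn g ω (Ici t₀) x := by
  let P : ℕ → (ℝ → E) → Prop := fun n X =>
    X t₀ = x₀ ∧ IsSolutionOn g ω (Icc t₀ (t₀ + n * τ)) X ∧ X (t₀ + n * τ) ∈ S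
  have hle : ∀ n : ℕ, t₀ ≤ t₀ + n * τ := fun n => le_add_of_nonneg_right (by positivity)
  have hsucc : ∀ n : ℕ, t₀ + (n + 1 : ℕ) * τ = t₀ + n * τ + τ := fun n => by push_cast; ring
  have h0 : ∃ X, P 0 X := by
    refine ⟨fun _ => x₀, rfl, fun t ht => ?_, hx₀⟩
    have : Icc t₀ (t₀ + (0 : ℕ) * τ) = {t₀} := by simp
    rw [this] at ht ⊢
    rw [mem_singleton_iff] at ht
    subst ht
    exact HasFDerivWithinAt.of_subsingleton subsingleton_singleton
  have hstep : ∀ n X, P n X → ∃ Y, P (n + 1) Y ∧ ∀ t ∈ Icc t₀ (t₀ + n * τ), Y t = X t := by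
    rintro n X ⟨hX0, hX, hXS⟩
    obtain ⟨y, hy0, hy⟩ := hex _ _ hXS
    refine ⟨fun t => if t ≤ t₀ + n * τ then X t else y t, ⟨?_, ?_, ?_⟩, fun t ht => if_pos ht.2⟩
    · simpa [hle n] using hX0
    · rw [hsucc]
      exact hX.glue (hle n) (by linarith) hy hy0.symm
    · simp only [hsucc, if_neg (show ¬t₀ + n * τ + τ ≤ t₀ + n * τ by linarith)]
      exact hinv _ y hy (hy0 ▸ hXS)
  choose X₀ hX₀ using h0
  choose! next hnext using hstep
  let X : ℕ → ℝ → E := fun n => Nat.rec X₀ next n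
  have hP : ∀ n, P n (X n) := fun n => by
    induction n with
    | zero => exact hX₀
    | succ n ih => exact (hnext n _ ih).1
  have hext : ∀ n k : ℕ, n ≤ k → ∀ t ∈ Icc t₀ (t₀ + n * τ), X k t = X n t := by
    intro n k hnk t ht
    induction k, hnk using Nat.le_induction with
    | base => rfl
    | succ k hk ih =>
      rw [← ih]
      refine (hnext k _ (hP k)).2 t ⟨ht.1, ht.2.trans ?_⟩
      gcongr
  have hceil : ∀ t, t ≤ t₀ + ⌈(t - t₀) / τ⌉₊ * τ := fun t => by
    have := (div_le_iff₀ hτ).1 (Nat.le_ceil ((t - t₀) / τ))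
    linarith
  have heq : ∀ n : ℕ, ∀ t ∈ Icc t₀ (t₀ + n * τ), X ⌈(t - t₀) / τ⌉₊ t = X n t := by
    intro n t ht
    refine (hext _ n (Nat.ceil_le.2 ((div_le_iff₀ hτ).2 ?_)) t ⟨ht.1, hceil t⟩).symm
    linarith [ht.2]
  refine ⟨fun t => X ⌈(t - t₀) / τ⌉₊ t, ?_, fun t ht => ?_⟩
  · simpa using (hP 0).1
  -- The extra step puts `t` strictly before the right end point, so the derivative within the
  -- compact interval is also one within `Ici t₀`.
  · set n : ℕ := ⌈(t - t₀) / τ⌉₊ + 1 with hn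
    have hlt : t < t₀ + n * τ := by
      have := hceil t
      rw [hn, hsucc]
      linarith
    have htn : t ∈ Icc t₀ (t₀ + n * τ) := ⟨ht, hlt.le⟩
    have h := ((hP n).2.1 t htn).congr (heq n) (heq n t htn)
    rw [← heq n t htn] at h
    refine h.mono_of_mem_nhdsWithin ?_
    rw [← Ici_inter_Iic]
    exact Filter.inter_mem self_mem_nhdsWithin (mem_nhdsWithin_of_mem_nhds (Iic_mem_nhds hlt))

end

/-! ### Growth of a block norm over one period -/

section

open MeasureTheory Set intervalIntegral

/-- The rotated array `ẋ = ℓᶜ(x, ω t)` as a time-dependent vector field with parameter `ω`. -/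
def rotatedArray {m : ℕ} (f : ℝ → ℝ) (γ : Fin m → Fin m → ℝ → ℝ) : State m → ℝ → ℝ → State m :=
  fun x ω t => rotatedField f γ x (ω * t)

theorem integral_comp_mul_of_periodic {h : ℝ → ℝ} (hh : Function.Periodic h (2 * Real.pi)) {ω : ℝ}
    (hω : ω ≠ 0) (s : ℝ) :
    ∫ t in s..(s + 2 * Real.pi / ω), h (ω * t) = ω⁻¹ * ∫ φ in (0 : ℝ)..(2 * Real.pi), h φ := by
  rw [intervalIntegral.integral_comp_mul_left h hω, smul_eq_mul, mul_add,
    mul_div_cancel₀ _ hω, hh.intervalIntegral_add_eq (ω * s) 0, zero_add]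

theorem continuous_inner_rotatedField {m : ℕ} {f : ℝ → ℝ} {γ : Fin m → Fin m → ℝ → ℝ}
    (hf : LocallyLipschitz f) (hγ : ∀ i j : Fin m, i ≠ j → LocallyLipschitz (γ i j)) (i : Fin m) :
    Continuous fun p : State m × ℝ => inner ℝ (p.1 i) (rotatedField f γ p.1 p.2 i) :=
  Continuous.inner (by fun_prop) (locallyLipschitz_rotatedBlock hf hγ i).continuous

theorem inner_rotatedField_sub_le {m : ℕ} {f : ℝ → ℝ} {γ : Fin m → Fin m → ℝ → ℝ} {R C : ℝ}
    {L : ℝ≥0} {S : Set (State m)} {φ : ℝ}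
    (hL : LipschitzOnWith L (fun x => rotatedField f γ x φ) S)
    (hC : ∀ z ∈ S, ‖rotatedField f γ z φ‖ ≤ C) {x y : State m} (hx : x ∈ S) (hy : y ∈ S)
    {i : Fin m} (hyR : ‖y i‖ ≤ R) :
    inner ℝ (x i) (rotatedField f γ x φ i) - inner ℝ (y i) (rotatedField f γ y φ i)
      ≤ (C + R * L) * ‖x - y‖ := by
  have h1 : ‖x i - y i‖ ≤ ‖x - y‖ := PiLp.norm_apply_le (x - y) i
  have h2 : ‖rotatedField f γ x φ i‖ ≤ C := (PiLp.norm_apply_le _ i).trans (hC x hx)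
  have h3 : ‖rotatedField f γ x φ i - rotatedField f γ y φ i‖ ≤ L * ‖x - y‖ := by
    have h := hL.dist_le_mul x hx y hy
    rw [dist_eq_norm, dist_eq_norm] at h
    exact (PiLp.norm_apply_le (rotatedField f γ x φ - rotatedField f γ y φ) i).trans h
  have e : inner ℝ (x i) (rotatedField f γ x φ i) - inner ℝ (y i) (rotatedField f γ y φ i)
      = inner ℝ (x i - y i) (rotatedField f γ x φ i)
        + inner ℝ (y i) (rotatedField f γ x φ i - rotatedField f γ y φ i) := by
    rw [inner_sub_left, inner_sub_right]; ring
  rw [e]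
  calc _ ≤ ‖x i - y i‖ * ‖rotatedField f γ x φ i‖
        + ‖y i‖ * ‖rotatedField f γ x φ i - rotatedField f γ y φ i‖ :=
        add_le_add (real_inner_le_norm _ _) (real_inner_le_norm _ _)
    _ ≤ ‖x - y‖ * C + R * (L * ‖x - y‖) := by
        have := (norm_nonneg (y i)).trans hyR
        gcongr
    _ = _ := by ring

/-- The state is frozen at the start of the period. It moves by at most `C * τ`, and the integrand
varies with constant `C + R * L`, so the error integrates to order `τ²`; the frozen integrand
becomes a full-turn average. -/
theorem norm_sq_le_of_isSolutionOn {m : ℕ} {f : ℝ → ℝ} {γ : Fin m → Fin m → ℝ → ℝ}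
    (hf : LocallyLipschitz f) (hγ : ∀ i j : Fin m, i ≠ j → LocallyLipschitz (γ i j))
    {R C ω s : ℝ} {L : ℝ≥0}
    (hL : ∀ φ, LipschitzOnWith L (fun x => rotatedField f γ x φ) (discProduct m (R + 1)))
    (hC : ∀ φ, ∀ z ∈ discProduct m (R + 1), ‖rotatedField f γ z φ‖ < C)
    (hω : 0 < ω) (hCω : C * (2 * Real.pi / ω) ≤ 1) {x : ℝ → State m}
    (hx : IsSolutionOn (rotatedArray f γ) ω (Icc s (s + 2 * Real.pi / ω)) x)
    (hxs : x s ∈ discProduct m R) (i : Fin m) :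
    ‖x (s + 2 * Real.pi / ω) i‖ ^ 2 ≤ ‖x s i‖ ^ 2
      + 2 / ω * (∫ φ in (0 : ℝ)..(2 * Real.pi), inner ℝ (x s i) (rotatedField f γ (x s) φ i))
      + 2 * ((C + R * L) * C) * (2 * Real.pi / ω) ^ 2 := by
  set τ := 2 * Real.pi / ω with hτ
  have hτ0 : 0 < τ := by positivity
  have hball : ∀ z, ‖z - x s‖ ≤ 1 → z ∈ discProduct m (R + 1) := fun z hz =>
    mem_discProduct_of_norm_sub_le hxs hz
  have hC0 : 0 < C := (norm_nonneg _).trans_lt (hC 0 (x s) (hball _ (by simp)))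
  have hR0 : 0 ≤ R := (norm_nonneg _).trans (hxs i)
  have hstay : ∀ t ∈ Icc s (s + τ), ‖x t - x s‖ ≤ C * τ := fun t ht =>
    (hx.norm_sub_le (fun r z hz => hC _ z (hball z hz)) (by simpa using hCω) ht).trans
      (mul_le_mul_of_nonneg_left (by linarith [ht.2]) hC0.le)
  obtain ⟨H, hcont, hH⟩ : ∃ H : State m × ℝ → ℝ, Continuous H ∧
      ∀ z φ, inner ℝ (z i) (rotatedField f γ z φ i) = H (z, φ) :=
    ⟨_, continuous_inner_rotatedField hf hγ i, fun _ _ => rfl⟩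
  simp only [hH]
  have hder : ∀ t ∈ Icc s (s + τ), HasDerivWithinAt (fun t => ‖x t i‖ ^ 2)
      (2 * H (x t, ω * t)) (Icc s (s + τ)) t := fun t ht => by
    rw [← hH]
    exact ((PiLp.proj (𝕜 := ℝ) 2 (fun _ : Fin m => Plane) i).hasFDerivAt.comp_hasDerivWithinAt t
      (hx t ht)).norm_sq
  have hpair : ContinuousOn (fun t => (x t, ω * t)) (Icc s (s + τ)) :=
    hx.continuousOn.prodMk (by fun_prop)
  have hint : IntervalIntegrable
      (fun t => 2 * H (x t, ω * t)) volume s (s + τ) := by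
    have hh : ContinuousOn (fun t => H (x t, ω * t))
        (Icc s (s + τ)) := hcont.comp_continuousOn hpair
    refine ContinuousOn.intervalIntegrable ?_
    rw [uIcc_of_le (by linarith)]
    exact hh.const_mul 2
  have hfund := intervalIntegral.integral_eq_sub_of_hasDerivAt_of_le
    (f := fun t => ‖x t i‖ ^ 2) (show s ≤ s + τ by linarith)
    (fun t ht => (hder t ht).continuousWithinAt)
    (fun t ht => (hder t (Ioo_subset_Icc_self ht)).hasDerivAt (Icc_mem_nhds ht.1 ht.2)) hint
  have hcs : Continuous fun φ => H (x s, φ) :=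
    hcont.comp (continuous_const.prodMk continuous_id)
  have hcs' : Continuous fun t => 2 * H (x s, ω * t) :=
    continuous_const.mul (hcs.comp (continuous_const.mul continuous_id))
  have hmono := intervalIntegral.integral_mono_on (a := s) (b := s + τ) (by linarith) hint
    ((hcs'.intervalIntegrable s (s + τ)).add (continuous_const.intervalIntegrable s (s + τ)))
    (g := fun t => 2 * H (x s, ω * t)
      + 2 * ((C + R * L) * (C * τ))) fun t ht => by
        have h1 := hstay t ht
        have h2 := inner_rotatedField_sub_le (hL (ω * t)) (fun z hz => (hC (ω * t) z hz).le)
          (hball _ (h1.trans hCω)) (hball (x s) (by simp)) (hxs i)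
        rw [hH, hH] at h2
        have h3 : (C + R * L) * ‖x t - x s‖ ≤ (C + R * L) * (C * τ) :=
          mul_le_mul_of_nonneg_left h1 (by positivity)
        linarith
  have hper : Function.Periodic (fun φ => H (x s, φ))
      (2 * Real.pi) := fun φ => by
    simp only [← hH, (rotatedField_periodic f γ (x s)) φ]
  rw [hfund, intervalIntegral.integral_add (hcs'.intervalIntegrable _ _)
    (continuous_const.intervalIntegrable _ _), intervalIntegral.integral_const_mul,
    integral_comp_mul_of_periodic hper hω.ne', intervalIntegral.integral_const, smul_eq_mul] at hmono
  have e1 : (s + τ - s) * (2 * ((C + R * L) * (C * τ))) = 2 * ((C + R * L) * C) * τ ^ 2 := by ring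
  have e2 : ∀ J : ℝ, 2 * (ω⁻¹ * J) = 2 / ω * J := fun J => by ring
  rw [e1, e2] at hmono
  linarith

end

/-! ### Decrease per period and practical stability -/

section

open Set

theorem eventually_mul_two_pi_div_le (a : ℝ) {b : ℝ} (hb : 0 < b) :
    ∀ᶠ ω in Filter.atTop, a * (2 * Real.pi / ω) ≤ b := by
  have h : Filter.Tendsto (fun ω : ℝ => a * (2 * Real.pi / ω)) Filter.atTop (nhds (a * 0)) :=
    (Filter.tendsto_id.const_div_atTop _).const_mul a
  rw [mul_zero] at h
  exact h.eventually_le_const hb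

theorem exists_pos_le_sq_mul_angularMoment {f : ℝ → ℝ} (hf : Continuous f) {ρ a b : ℝ}
    (hρ : 0 < ρ) (hA : ∀ s, ρ < s → 0 < angularMoment f s) (ha : ρ < a) :
    ∃ c, 0 < c ∧ ∀ p ∈ Icc a b, c ≤ 4 * (p ^ 2 * angularMoment f p) := by
  have hc := continuous_angularMoment hf
  have hpos : ∀ p ∈ Icc a b, 0 < 4 * (p ^ 2 * angularMoment f p) := fun p hp => by
    have h1 : ρ < p := ha.trans_le hp.1
    have := hA p h1
    have := hρ.trans h1
    positivity
  rcases (Icc a b).eq_empty_or_nonempty with h | h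
  · exact ⟨1, one_pos, fun p hp => by simp [h] at hp⟩
  · obtain ⟨p, hp, hmin⟩ := isCompact_Icc.exists_isMinOn h
      (f := fun p => 4 * (p ^ 2 * angularMoment f p)) (by fun_prop)
    exact ⟨_, hpos p hp, fun q hq => hmin hq⟩

theorem continuous_rotatedArray {m : ℕ} {f : ℝ → ℝ} {γ : Fin m → Fin m → ℝ → ℝ}
    (hf : LocallyLipschitz f) (hγ : ∀ i j : Fin m, i ≠ j → LocallyLipschitz (γ i j)) (ω : ℝ)
    (z : State m) : Continuous fun t => rotatedArray f γ z ω t := by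
  have h := (continuous_rotatedField hf hγ).comp (Continuous.prodMk_right z)
  exact h.comp (continuous_const_mul ω)

/-- A short period absorbs the coupling: `p² + p (v - p) = p v ≤ v²`. Half of the damping gain pays
for the second-order error; the other half is `2 η τ R ≥ 2 η τ v`, whence `q² ≤ v² - 2 η τ v ≤ (v -
η τ)²`. -/
theorem le_sub_of_averaged_decrease {ω p q v R c η k K J : ℝ} (hω : 0 < ω) (hq : 0 ≤ q)
    (hp : 0 ≤ p) (hpv : p ≤ v) (hvR : v ≤ R) (hv : 0 ≤ v - η * (2 * Real.pi / ω))
    (hqp : q ^ 2 ≤ p ^ 2 + 2 / ω * J + K * (2 * Real.pi / ω) ^ 2)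
    (hJ : J ≤ -c + k * (p * (v - p))) (hk : k / Real.pi * (2 * Real.pi / ω) ≤ 1)
    (hK : K * (2 * Real.pi / ω) ≤ c / (2 * Real.pi)) (hη : 2 * η * R = c / (2 * Real.pi))
    (hη0 : 0 ≤ η) : q ≤ v - η * (2 * Real.pi / ω) := by
  have hpi := Real.pi_pos
  have h4 : 2 / ω * J ≤ 2 / ω * (-c + k * (p * (v - p))) :=
    mul_le_mul_of_nonneg_left hJ (by positivity)
  have e4 : 2 / ω * (-c + k * (p * (v - p))) = -(2 * (2 * Real.pi / ω) * (c / (2 * Real.pi)))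
      + k / Real.pi * (2 * Real.pi / ω) * (p * (v - p)) := by
    field_simp
  rw [e4] at h4
  have hτ0 : 0 < 2 * Real.pi / ω := by positivity
  set τ := 2 * Real.pi / ω
  have h5 : k / Real.pi * τ * (p * (v - p)) ≤ 1 * (p * (v - p)) :=
    mul_le_mul_of_nonneg_right hk (mul_nonneg hp (sub_nonneg.2 hpv))
  have h6 : K * τ ^ 2 ≤ c / (2 * Real.pi) * τ := by
    rw [sq, ← mul_assoc]
    exact mul_le_mul_of_nonneg_right hK hτ0.le
  have h7 : η * τ * v ≤ η * τ * R := mul_le_mul_of_nonneg_left hvR (by positivity)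
  have h8 : p * v ≤ v * v := mul_le_mul_of_nonneg_right hpv (hp.trans hpv)
  have h9 : c / (2 * Real.pi) * τ = 2 * (η * τ * R) := by rw [← hη]; ring
  refine (sq_le_sq₀ hq hv).1 ?_
  nlinarith [sq_nonneg (η * τ)]

/-- The estimates for a fast rotation: within one period the array moves by at most `d`, over a
full period the largest block norm `v ≥ ρ + d` decreases at the average rate `η`, and solutions
starting in `discProduct m R` are global. -/
theorem exists_period_estimates {m : ℕ} {f : ℝ → ℝ} {γ : Fin m → Fin m → ℝ → ℝ}
    (hf : LocallyLipschitz f) (hf_even : Function.Even f)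
    (hγ_lip : ∀ i j : Fin m, i ≠ j → LocallyLipschitz (γ i j)) (hγ : IsInterconnection γ)
    {ρ d R : ℝ} (hρ : 0 < ρ) (hA : ∀ s, ρ < s → 0 < angularMoment f s) (hd : 0 < d)
    (hR : ρ + d ≤ R) :
    ∃ η : ℝ, 0 < η ∧ ∃ ωstar : ℝ, 0 < ωstar ∧ ∀ ω, ωstar ≤ ω →
      (∀ (s t : ℝ) (x : ℝ → State m) (v : ℝ), s ≤ t → t ≤ s + 2 * Real.pi / ω →
        IsSolutionOn (rotatedArray f γ) ω (Icc s t) x → v ≤ R → x s ∈ discProduct m v →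
        x t ∈ discProduct m (v + d)) ∧
      (∀ (s : ℝ) (x : ℝ → State m) (v : ℝ),
        IsSolutionOn (rotatedArray f γ) ω (Icc s (s + 2 * Real.pi / ω)) x → ρ + d ≤ v → v ≤ R →
        x s ∈ discProduct m v →
        x (s + 2 * Real.pi / ω) ∈ discProduct m (v - η * (2 * Real.pi / ω))) ∧
      ∀ (t₀ : ℝ), ∀ x₀ ∈ discProduct m R,
        ∃ x : ℝ → State m, x t₀ = x₀ ∧ IsSolutionOn (rotatedArray f γ) ω (Ici t₀) x := by
  have hpi := Real.pi_pos
  have hR0 : 0 < R := by linarith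
  obtain ⟨L, hL⟩ := exists_lipschitzOnWith_rotatedField hf hγ_lip (R + 1)
  obtain ⟨C, hC0, hC⟩ : ∃ C : ℝ≥0, 0 < C ∧ ∀ φ, ∀ z ∈ discProduct m (R + 1),
      ‖rotatedField f γ z φ‖ < C := by
    refine ⟨⟨L * (m * (R + 1)) + 1, by positivity⟩, ?_, fun φ z hz => ?_⟩
    · change (0 : ℝ) < L * (m * (R + 1)) + 1
      positivity
    · exact (norm_rotatedField_le hγ (by linarith) (hL φ) hz).trans_lt (lt_add_one _)
  obtain ⟨K, hK0, hK⟩ := exists_linear_bound_interconnection hγ_lip hγ (2 * R)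
  obtain ⟨c, hc0, hc⟩ := exists_pos_le_sq_mul_angularMoment hf.continuous hρ hA
    (show ρ < ρ + d / 2 by linarith) (b := R)
  -- Chosen so that `2 * η * R` is half of the mean damping gain `2 * (c / (2π))` per unit time.
  set η : ℝ := c / (4 * Real.pi * R) with hη
  have hη0 : 0 < η := by positivity
  have hηR : 2 * η * R = c / (2 * Real.pi) := by rw [hη]; field_simp; norm_num
  set K₁ : ℝ := 2 * ((C + R * L) * C) with hK₁
  obtain ⟨ω₁, hω₁⟩ := Filter.eventually_atTop.1
    (((eventually_mul_two_pi_div_le C one_pos).and (eventually_mul_two_pi_div_le C hd)).and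
    (((eventually_mul_two_pi_div_le (m * (2 * Real.pi * K) / Real.pi) one_pos).and
      (eventually_mul_two_pi_div_le K₁ (show 0 < c / (2 * Real.pi) by positivity))).and
      ((eventually_mul_two_pi_div_le η hρ).and
        (eventually_mul_two_pi_div_le (C + η) (half_pos hd)))))
  refine ⟨η, hη0, max ω₁ 1, by positivity, fun ω hω => ?_⟩
  have hω0 : 0 < ω := one_pos.trans_le ((le_max_right _ _).trans hω)
  obtain ⟨⟨hτ1, hτd⟩, ⟨hτK, hτK₁⟩, hτρ, hτη⟩ := hω₁ ω ((le_max_left _ _).trans hω)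
  set τ := 2 * Real.pi / ω with hτ
  have hτ0 : 0 < τ := by positivity
  have hball : ∀ y ∈ discProduct m R, ∀ z, ‖z - y‖ ≤ 1 → z ∈ discProduct m (R + 1) :=
    fun y hy z hz => mem_discProduct_of_norm_sub_le hy hz
  have hmove : ∀ (s t : ℝ) (x : ℝ → State m), s ≤ t → t ≤ s + τ →
      IsSolutionOn (rotatedArray f γ) ω (Icc s t) x → x s ∈ discProduct m R →
      ‖x t - x s‖ ≤ C * τ := by
    intro s t x hst htτ hx hxs
    have h1 : (C : ℝ) * (t - s) ≤ C * τ := by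
      gcongr
      linarith
    exact (hx.norm_sub_le (fun r z hz => hC _ z (hball _ hxs z hz)) (h1.trans hτ1)
      (right_mem_Icc.2 hst)).trans h1
  have hdec : ∀ (s : ℝ) (x : ℝ → State m) (v : ℝ),
      IsSolutionOn (rotatedArray f γ) ω (Icc s (s + τ)) x → ρ + d ≤ v → v ≤ R →
      x s ∈ discProduct m v → x (s + τ) ∈ discProduct m (v - η * τ) := by
    intro s x v hx hv hvR hxs i
    have hxR := discProduct_mono hvR hxs
    have hvp : 0 ≤ v - ‖x s i‖ := sub_nonneg.2 (hxs i)
    have hp0 := norm_nonneg (x s i)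
    -- A block below `ρ + d / 2` may grow, but in one period it cannot use up the remaining margin
    -- `d / 2`, even after reserving `η * τ`. A block above it has damping at least `c`.
    rcases lt_or_ge ‖x s i‖ (ρ + d / 2) with h | h
    · have h1 : ‖(x (s + τ) - x s) i‖ ≤ C * τ :=
        (PiLp.norm_apply_le _ i).trans (hmove s (s + τ) x (by linarith) le_rfl hx hxR)
      have h2 : ‖x (s + τ) i‖ ≤ ‖x s i‖ + ‖(x (s + τ) - x s) i‖ := by
        have e : x (s + τ) i = x s i + (x (s + τ) - x s) i := by simp
        conv_lhs => rw [e]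
        exact norm_add_le _ _
      rw [add_mul] at hτη
      linarith
    · have h1 := norm_sq_le_of_isSolutionOn hf hγ_lip hL hC hω0 hτ1 hx hxR i
      have h2 := integral_inner_rotatedField_le hf.continuous hf_even
        (fun i j hij => (hγ_lip i j hij).continuous) hγ hK0
        (fun i j hij s hs => hK i j hij s (hs.trans (by linarith))) hxs i
      have h3 := hc ‖x s i‖ ⟨h, by linarith⟩
      exact le_sub_of_averaged_decrease hω0 (norm_nonneg _) hp0 (hxs i) hvR (by linarith)
        h1 (k := m * (2 * Real.pi * K))
        (h2.trans ((add_le_add (neg_le_neg h3) le_rfl).trans_eq (by ring))) hτK hτK₁ hηR hη0.le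
  refine ⟨fun s t x v hst htτ hx hv hxs => ?_, hdec, fun t₀ x₀ hx₀ => ?_⟩
  · exact mem_discProduct_of_norm_sub_le hxs
      ((hmove s t x hst htτ hx (discProduct_mono hv hxs)).trans hτd)
  · refine exists_isSolutionOn_Ici hτ0 (S := discProduct m R) (fun s y hy => ?_)
      (fun s x hx hxs => ?_) t₀ hx₀
    · have hsub : Metric.closedBall y 1 ⊆ discProduct m (R + 1) := fun z hz =>
        hball y hy z (mem_closedBall_iff_norm.1 hz)
      exact exists_isSolutionOn_Icc (g := rotatedArray f γ) (ω := ω)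
        (continuous_rotatedArray hf hγ_lip ω) (fun t => (hL (ω * t)).mono hsub)
        (fun t z hz => (hC (ω * t) z (hsub hz)).le) hτ0.le hτ1 s
    · exact discProduct_mono (by linarith [mul_pos hη0 hτ0]) (hdec s x R hx hR le_rfl hxs)

/-- Scaling by `ρ / (ρ + a)` gives a competitor; the factor `m` comes from bounding the norm by the
sum of block norms. -/
theorem infDist_discProduct_le {m : ℕ} {ρ a : ℝ} (hρ : 0 < ρ) (ha : 0 ≤ a) {x : State m}
    (hx : x ∈ discProduct m (ρ + a)) : Metric.infDist x (discProduct m ρ) ≤ m * a := by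
  have hs : 0 < ρ + a := by linarith
  have hy : (ρ / (ρ + a)) • x ∈ discProduct m ρ := fun i => by
    rw [PiLp.smul_apply, norm_smul, Real.norm_of_nonneg (by positivity)]
    calc _ ≤ ρ / (ρ + a) * (ρ + a) := by gcongr; exact hx i
      _ = ρ := by field_simp
  refine (Metric.infDist_le_dist_of_mem hy).trans ?_
  have e : x - (ρ / (ρ + a)) • x = (a / (ρ + a)) • x := by
    nth_rw 1 [← one_smul ℝ x]
    rw [← sub_smul]
    congr 1
    field_simp
    ring
  rw [dist_eq_norm, e, norm_smul, Real.norm_of_nonneg (by positivity)]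
  calc _ ≤ a / (ρ + a) * (m * (ρ + a)) := by gcongr; exact norm_le_of_mem_discProduct hx
    _ = _ := by field_simp

theorem mem_discProduct_of_infDist_lt {m : ℕ} {ρ a : ℝ} (hρ : 0 ≤ ρ) {x : State m}
    (hx : Metric.infDist x (discProduct m ρ) < a) : x ∈ discProduct m (ρ + a) := by
  have hne : (discProduct m ρ).Nonempty := ⟨0, fun i => by simpa using hρ⟩
  obtain ⟨y, hy, hxy⟩ := (Metric.infDist_lt_iff hne).1 hx
  exact mem_discProduct_of_norm_sub_le hy (by rw [← dist_eq_norm]; exact hxy.le)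

theorem mem_discProduct_of_period_decrease {m : ℕ} {g : State m → ℝ → ℝ → State m}
    {ω τ b R q : ℝ} (hτ : 0 < τ) (hq : 0 ≤ q) (hbR : b ≤ R)
    (hdec : ∀ (s : ℝ) (x : ℝ → State m) (v : ℝ), IsSolutionOn g ω (Icc s (s + τ)) x → b ≤ v →
      v ≤ R → x s ∈ discProduct m v → x (s + τ) ∈ discProduct m (v - q))
    {s : ℝ} {x : ℝ → State m} {v : ℝ} (hv : v ≤ R) (hxs : x s ∈ discProduct m v) (n : ℕ)
    (hx : IsSolutionOn g ω (Icc s (s + n * τ)) x) :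
    x (s + n * τ) ∈ discProduct m (max b (v - n * q)) := by
  induction n with
  | zero => simpa using discProduct_mono (le_max_right b v) hxs
  | succ n ih =>
    have e : s + (n + 1 : ℕ) * τ = s + n * τ + τ := by push_cast; ring
    have hn : 0 ≤ (n : ℝ) * τ := by positivity
    have hnq : 0 ≤ (n : ℝ) * q := by positivity
    rw [e] at hx ⊢
    have h := hdec (s + n * τ) x (max b (v - n * q)) (hx.mono (Icc_subset_Icc (by linarith) le_rfl))
      (le_max_left _ _) (max_le hbR (by linarith))
      (ih (hx.mono (Icc_subset_Icc le_rfl (by linarith))))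
    refine discProduct_mono ?_ h
    rw [sub_le_iff_le_add]
    refine max_le (by linarith [le_max_left b (v - (n + 1 : ℕ) * q)]) ?_
    have := le_max_right b (v - (n + 1 : ℕ) * q)
    push_cast at this ⊢
    linarith

/-- The whole periods lower the level down to the floor `b`; the final incomplete period costs `d`.
-/
theorem mem_discProduct_of_period_estimates {m : ℕ} {g : State m → ℝ → ℝ → State m}
    {ω τ b d R q : ℝ} (hτ : 0 < τ) (hq : 0 ≤ q) (hbR : b ≤ R)
    (hmove : ∀ (s t : ℝ) (x : ℝ → State m) (v : ℝ), s ≤ t → t ≤ s + τ →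
      IsSolutionOn g ω (Icc s t) x → v ≤ R → x s ∈ discProduct m v → x t ∈ discProduct m (v + d))
    (hdec : ∀ (s : ℝ) (x : ℝ → State m) (v : ℝ), IsSolutionOn g ω (Icc s (s + τ)) x → b ≤ v →
      v ≤ R → x s ∈ discProduct m v → x (s + τ) ∈ discProduct m (v - q))
    {s t : ℝ} {x : ℝ → State m} {v : ℝ} (hv : v ≤ R) (hxs : x s ∈ discProduct m v)
    (hx : IsSolutionOn g ω (Icc s t) x) (n : ℕ) (hn : s + n * τ ≤ t) :
    x t ∈ discProduct m (max b (v - n * q) + d) := by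
  have hst : 0 ≤ t - s := by
    have : 0 ≤ (n : ℝ) * τ := by positivity
    linarith
  set k := ⌊(t - s) / τ⌋₊
  have hk1 : s + k * τ ≤ t := by
    have := (le_div_iff₀ hτ).1 (Nat.floor_le (div_nonneg hst hτ.le))
    linarith
  have hk2 : t ≤ s + k * τ + τ := by
    have := (div_lt_iff₀ hτ).1 (Nat.lt_floor_add_one ((t - s) / τ))
    linarith
  have hnk : n ≤ k := Nat.le_floor ((le_div_iff₀ hτ).2 (by linarith))
  have hkτ : 0 ≤ (k : ℝ) * τ := by positivity
  have hkq : 0 ≤ (k : ℝ) * q := by positivity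
  have h := mem_discProduct_of_period_decrease hτ hq hbR hdec hv hxs k
    (hx.mono (Icc_subset_Icc le_rfl hk1))
  refine discProduct_mono ?_ (hmove _ t x _ hk1 hk2
    (hx.mono (Icc_subset_Icc (by linarith) le_rfl)) (max_le hbR (by linarith)) h)
  gcongr

theorem isSPAS_rotatedArray {m : ℕ} {f : ℝ → ℝ} {γ : Fin m → Fin m → ℝ → ℝ}
    (hf : LocallyLipschitz f) (hf_even : Function.Even f)
    (hγ_lip : ∀ i j : Fin m, i ≠ j → LocallyLipschitz (γ i j)) (hγ : IsInterconnection γ)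
    {ρ : ℝ} (hρ : 0 < ρ) (hA : ∀ s, ρ < s → 0 < angularMoment f s) :
    IsSPAS (rotatedArray f γ) (discProduct m ρ) := by
  refine ⟨isClosed_discProduct m ρ, fun Δ δ hΔ hδ => ?_⟩
  -- One `d` is for the floor `ρ + d`, the other for the incomplete period; `m` converts block
  -- excess into distance.
  obtain ⟨d, hd, hdδ⟩ : ∃ d : ℝ, 0 < d ∧ m * (d + d) ≤ δ := by
    refine ⟨δ / (2 * (m + 1)), by positivity, ?_⟩
    rw [← two_mul, ← mul_assoc, mul_div_assoc', div_le_iff₀ (by positivity)]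
    nlinarith
  set R := ρ + Δ + d with hR
  obtain ⟨η, hη, ωstar, hωs, h⟩ := exists_period_estimates hf hf_even hγ_lip hγ hρ hA hd
    (show ρ + d ≤ R by linarith)
  refine ⟨ωstar, hωs, fun ω hω => ?_⟩
  have hω0 := hωs.trans_le hω
  have hpi := Real.pi_pos
  obtain ⟨hmove, hdec, hex⟩ := h ω hω
  have hτ0 : 0 < 2 * Real.pi / ω := by positivity
  set τ := 2 * Real.pi / ω
  have hq : 0 < η * τ := by positivity
  have hmain := fun {s t : ℝ} {x : ℝ → State m} {v : ℝ} =>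
    mem_discProduct_of_period_estimates (s := s) (t := t) (x := x) (v := v) hτ0 hq.le
      (show ρ + d ≤ R by linarith) hmove hdec
  have hstart : ∀ {y : State m}, Metric.infDist y (discProduct m ρ) < Δ → y ∈ discProduct m R :=
    fun hy => discProduct_mono (by linarith) (mem_discProduct_of_infDist_lt hρ.le hy)
  refine ⟨fun t₀ x₀ hx₀ => hex t₀ x₀ (hstart hx₀), fun r hr => ⟨d / 2, half_pos hd, ?_⟩,
    fun ε hε => ⟨m * (Δ + d + d) + 1, by positivity, ?_⟩, fun r ε hr hε => ?_⟩
  · intro t₀ t x ht hx hx0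
    have h1 := hmain (by linarith) (mem_discProduct_of_infDist_lt hρ.le
      (hx0.trans_lt (half_lt_self hd))) hx 0 (by simpa using ht)
    have h2 : x t ∈ discProduct m (ρ + (d + d)) := discProduct_mono (by simp [add_assoc]) h1
    linarith [infDist_discProduct_le hρ (by linarith) h2]
  · intro t₀ t x ht hx hx0
    have h1 := hmain le_rfl (hstart (hx0.trans_lt hε)) hx 0 (by simpa using ht)
    have h2 : x t ∈ discProduct m (ρ + (Δ + d + d)) := by
      refine discProduct_mono ?_ h1
      rw [max_eq_right (by simp; linarith)]
      simp [hR]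
      linarith
    linarith [infDist_discProduct_le hρ (by linarith) h2]
  -- `n` periods suffice to descend from level `R` to the floor `ρ + d`, losing `η * τ` in each.
  · obtain ⟨n, hn⟩ := exists_nat_ge ((R - (ρ + d)) / (η * τ))
    rw [div_le_iff₀ hq] at hn
    refine ⟨n * τ + 1, by positivity, fun t₀ t x ht hx hx0 => ?_⟩
    have h1 := hmain le_rfl (hstart (hx0.trans_lt hr)) hx n (by linarith)
    have h2 : x t ∈ discProduct m (ρ + (d + d)) := by
      refine discProduct_mono ?_ h1
      rw [max_eq_left (by linarith)]
      linarith
    linarith [infDist_discProduct_le hρ (by linarith) h2]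

end

end

end LienardArray

theorem mainTheorem5 {m : ℕ} (f : ℝ → ℝ) (γ : Fin m → Fin m → ℝ → ℝ)
    (hf : LocallyLipschitz f) (hf_even : Function.Even f)
    (hF : LienardArray.LienardSign (LienardArray.primitive f))
    (hγ_lip : ∀ i j : Fin m, i ≠ j → LocallyLipschitz (γ i j))
    (hγ : LienardArray.IsInterconnection γ)
    (hγ_conn : LienardArray.IsConnectedInterconnection γ) :
    (∃! ρ : ℝ, 0 < ρ ∧ LienardArray.kappa f ρ = 0) ∧
    ∀ ρ : ℝ, 0 < ρ → LienardArray.kappa f ρ = 0 →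
      LienardArray.IsSPAS
        (fun (x : LienardArray.State m) (ω t : ℝ) => LienardArray.rotatedField f γ x (ω * t))
        (LienardArray.discProduct m ρ) :=
  ⟨LienardArray.existsUnique_kappa_eq_zero hf.continuous hF, fun _ hρ hk =>
    LienardArray.isSPAS_rotatedArray hf hf_even hγ_lip hγ hρ fun _ hs =>
      LienardArray.angularMoment_pos_of_kappa_eq_zero hf.continuous hF hρ hk hs⟩
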